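/- All graphs are finite, simple and nonnull. A clique is a (possibly empty) set of pairwise adjacent vertices; for disjoint vertex sets $S,T$, $S$ is complete (anticomplete) to $T$ if all (no) edges between $S$ and $T$ are present. $N_G(v)$ is the set of neighbors of $v$. A vertex is simplicial if its neighbors form a clique, and universal if it is adjacent to all other vertices. $G$ is $H$-free if no induced subgraph of $G$ is isomorphic to $H$; $2P_3$ is the disjoint union of two three-vertex paths, and $C_k$ is the cycle on $k$ vertices. $T_0$ is the graph with vertices $a_0,a_1,b_0,b_1,b_2,b_3,c_1,c_2,c_3$ and edges $a_0a_1$, $a_0b_0$, $a_0b_2$, $a_0b_3$, $a_1b_1$, $a_1b_2$, $a_1b_3$, $b_0c_1$, $b_1c_1$, $b_2c_2$, $b_3c_3$, $c_1c_2$, $c_1c_3$, $c_2c_3$. The 3-pentagon is the graph with vertices $a,b_1,b_2,b_3,c_1,c_2,c_3$ and edges $ab_i$, $b_ic_i$ ($1\le i\le 3$) and $c_1c_2,c_1c_3,c_2c_3$. A 5-basket is a graph $Q$ whose vertex set can be partitioned into cliques $A,B_1,B_2,B_3,C_1,C_2,C_3,F$, all nonempty except possibly $F$, such that: $B_1,B_2,B_3$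 are pairwise anticomplete; $C_1,C_2,C_3$ are pairwise complete; for some $i^*\in\{1,2,3\}$, $A$ is complete to $B_i$ for all $i\ne i^*$ and $A$ can be ordered as $a_1,\dots,a_n$ with $N_Q(a_n)\cap B_{i^*}\subseteq\dots\subseteq N_Q(a_1)\cap B_{i^*}=B_{i^*}$; $A$ is anticomplete to $C_1\cup C_2\cup C_3$; each $B_i$ is complete to $C_i$ and anticomplete to $C_j$ for $j\neq i$; and for some $j^*\in\{1,2,3\}$, $F$ is complete to $V(Q)\setminus(B_{j^*}\cup C_{j^*}\cup F)$ and anticomplete to $B_{j^*}\cup C_{j^*}$. For $t\ge 3$, a $t$-villa is a graph $Q$ whose vertex set can be partitioned into nonempty cliques $A,B_1,\dots,B_t,C_1,\dots,C_t$ such that: $A$ is complete to every $B_i$ and anticomplete to every $C_i$; the $B_i$ are pairwise anticomplete; the $C_i$ are pairwise complete; $B_i$ is anticomplete to $C_j$ for $i\ne j$; and each $B_i$ can be ordered as $b_1,\dots,b_r$ with $\emptyset\ne N_Q(b_r)\cap C_i\subseteq\dots\subseteq N_Q(b_1)\cap C_i=C_i$. Such a partition is a $t$-villa partition. A villa is a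 $t$-villa for some $t\ge3$. For $t\ge 3$, a $t$-mansion is a graph $Q$ whose vertex set can be partitioned into cliques $A,B_1,\dots,B_t,C_1,\dots,C_t,F,X,Y$, all nonempty except possibly $X$ and $Y$, such that: $(A;B_1,\dots,B_t;C_1,\dots,C_t)$ is a $t$-villa partition of $Q\setminus(F\cup X\cup Y)$; for some $j^*\in\{1,\dots,t\}$, $F$ is complete to $A$ and to $B_i$ and $C_i$ for all $i\ne j^*$ and anticomplete to $B_{j^*}\cup C_{j^*}$, $B_{j^*}$ is complete to $C_{j^*}$, and $X$ is complete to $A\cup B_{j^*}$ and anticomplete to $B_i$ for all $i\ne j^*$ and to $C_1\cup\dots\cup C_t$; $F$ is complete to $X\cup Y$; $X$ is anticomplete to $Y$; and $Y$ is complete to $C_1\cup\dots\cup C_t$ and anticomplete to $A\cup B_1\cup\dots\cup B_t$. A mansion is a $t$-mansion for some $t\ge 3$. Lemma. Let $G$ be a $(2P_3,C_4,C_6,C_7,T_0)$-free graph that contains an induced 3-pentagon. Then $G$ is a 5-basket, a villa, or a mansion, or else $G$ contains a simplicial vertex or a universal vertex. -/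

import Mathlib

namespace FiveHoled

variable {V : Type*}

/-- A vertex is simplicial if its neighbors form a (possibly empty) clique. -/
def IsSimplicial (G : SimpleGraph V) (v : V) : Prop :=
  G.IsClique (G.neighborSet v)

/-- `G` is `H`-free: no induced subgraph of `G` is isomorphic to `H`. -/
def IndFree {W : Type*} (H : SimpleGraph W) (G : SimpleGraph V) : Prop :=
  ¬ H.IsIndContained G

/-- No vertex of `S` is adjacent to a vertex of `T`. -/
def IsAnticompleteBetween (G : SimpleGraph V) (S T : Set V) : Prop :=
  ∀ ⦃v⦄, v ∈ S → ∀ ⦃w⦄, w ∈ T → ¬ G.Adj v w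

/-- The disjoint union of two copies of the path on three vertices. -/
def twoP3 : SimpleGraph (Fin 3 ⊕ Fin 3) :=
  SimpleGraph.sum (SimpleGraph.pathGraph 3) (SimpleGraph.pathGraph 3)

/-- The graph `T₀` on nine vertices. The vertices are, in order,
`a₀, a₁, b₀, b₁, b₂, b₃, c₁, c₂, c₃`. -/
def T0 : SimpleGraph (Fin 9) :=
  SimpleGraph.fromEdgeSet
    {s(0, 1),                    -- a₀a₁
     s(0, 2), s(1, 3),           -- a₀b₀, a₁b₁
     s(0, 4), s(0, 5),           -- a₀b₂, a₀b₃
     s(1, 4), s(1, 5),           -- a₁b₂, a₁b₃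
     s(2, 6), s(3, 6),           -- b₀c₁, b₁c₁
     s(4, 7), s(5, 8),           -- b₂c₂, b₃c₃
     s(6, 7), s(6, 8), s(7, 8)}  -- c₁c₂, c₁c₃, c₂c₃

/-- The `2t + 1` vertices of the `t`-pentagon. -/
inductive PentagonVertex (t : ℕ) : Type
  | a : PentagonVertex t
  | b : Fin t → PentagonVertex t
  | c : Fin t → PentagonVertex t

/-- The `t`-pentagon: `a` is adjacent to all the `b i`, the `c i` form a clique, and `b i` is adjacent
to `c i`; there are no further edges (`fromRel` symmetrizes the relation and removes loops). -/
def pentagon (t : ℕ) : SimpleGraph (PentagonVertex t) :=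
  SimpleGraph.fromRel fun x y =>
    match x, y with
    | .a, .b _ => True
    | .b i, .c j => i = j
    | .c _, .c _ => True
    | _, _ => False

/-- `e 0, …, e n` is an ordering of the set `S` (without repetitions) such that
`N(e n) ∩ T ⊆ ⋯ ⊆ N(e 0) ∩ T = T`. -/
structure IsNestedOrdering (G : SimpleGraph V) (S T : Set V) {n : ℕ} (e : Fin (n + 1) → V) :
    Prop where
  injective : Function.Injective e
  range_eq : Set.range e = S
  antitone : ∀ k l, k ≤ l → G.neighborSet (e l) ∩ T ⊆ G.neighborSet (e k) ∩ T
  first : G.neighborSet (e 0) ∩ T = T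

/-- `(A; B₁, B₂, B₃; C₁, C₂, C₃; F)` is a 5-basket partition of `G`. -/
structure IsFiveBasketPartition (G : SimpleGraph V)
    (A : Set V) (B C : Fin 3 → Set V) (F : Set V) : Prop where
  disjoint_A_B : ∀ i, Disjoint A (B i)
  disjoint_A_C : ∀ i, Disjoint A (C i)
  disjoint_A_F : Disjoint A F
  disjoint_B_B : ∀ i j, i ≠ j → Disjoint (B i) (B j)
  disjoint_B_C : ∀ i j, Disjoint (B i) (C j)
  disjoint_B_F : ∀ i, Disjoint (B i) F
  disjoint_C_C : ∀ i j, i ≠ j → Disjoint (C i) (C j)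
  disjoint_C_F : ∀ i, Disjoint (C i) F
  cover : A ∪ (⋃ i, B i) ∪ (⋃ i, C i) ∪ F = Set.univ
  nonempty_A : A.Nonempty
  nonempty_B : ∀ i, (B i).Nonempty
  nonempty_C : ∀ i, (C i).Nonempty
  clique_A : G.IsClique A
  clique_B : ∀ i, G.IsClique (B i)
  clique_C : ∀ i, G.IsClique (C i)
  clique_F : G.IsClique F
  B_anticomplete_B : ∀ i j, i ≠ j → IsAnticompleteBetween G (B i) (B j)
  C_complete_C : ∀ i j, i ≠ j → G.IsCompleteBetween (C i) (C j)
  A_B : ∃ i₀ : Fin 3,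
    (∀ i, i ≠ i₀ → G.IsCompleteBetween A (B i)) ∧
    ∃ (n : ℕ) (e : Fin (n + 1) → V), IsNestedOrdering G A (B i₀) e
  A_anticomplete_C : ∀ i, IsAnticompleteBetween G A (C i)
  B_complete_C : ∀ i, G.IsCompleteBetween (B i) (C i)
  B_anticomplete_C : ∀ i j, i ≠ j → IsAnticompleteBetween G (B i) (C j)
  F_rest : ∃ j₀ : Fin 3,
    G.IsCompleteBetween F (B j₀ ∪ C j₀ ∪ F)ᶜ ∧
    IsAnticompleteBetween G F (B j₀ ∪ C j₀)

/-- `G` is a 5-basket. -/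
def IsFiveBasket (G : SimpleGraph V) : Prop :=
  ∃ (A : Set V) (B C : Fin 3 → Set V) (F : Set V), IsFiveBasketPartition G A B C F

/-- For `t ≥ 3`: `(A; B₁, …, Bₜ; C₁, …, Cₜ)` is a `t`-villa partition of the subgraph of `G`
induced by `S`. -/
structure IsVillaPartitionOn (G : SimpleGraph V) (S : Set V) {t : ℕ}
    (A : Set V) (B C : Fin t → Set V) : Prop where
  disjoint_A_B : ∀ i, Disjoint A (B i)
  disjoint_A_C : ∀ i, Disjoint A (C i)
  disjoint_B_B : ∀ i j, i ≠ j → Disjoint (B i) (B j)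
  disjoint_B_C : ∀ i j, Disjoint (B i) (C j)
  disjoint_C_C : ∀ i j, i ≠ j → Disjoint (C i) (C j)
  cover : A ∪ (⋃ i, B i) ∪ (⋃ i, C i) = S
  nonempty_A : A.Nonempty
  nonempty_B : ∀ i, (B i).Nonempty
  nonempty_C : ∀ i, (C i).Nonempty
  clique_A : G.IsClique A
  clique_B : ∀ i, G.IsClique (B i)
  clique_C : ∀ i, G.IsClique (C i)
  A_complete_B : ∀ i, G.IsCompleteBetween A (B i)
  A_anticomplete_C : ∀ i, IsAnticompleteBetween G A (C i)
  B_anticomplete_B : ∀ i j, i ≠ j → IsAnticompleteBetween G (B i) (B j)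
  C_complete_C : ∀ i j, i ≠ j → G.IsCompleteBetween (C i) (C j)
  B_anticomplete_C : ∀ i j, i ≠ j → IsAnticompleteBetween G (B i) (C j)
  B_C : ∀ i, ∃ (n : ℕ) (e : Fin (n + 1) → V), IsNestedOrdering G (B i) (C i) e ∧
    (G.neighborSet (e (Fin.last n)) ∩ C i).Nonempty

/-- `G` is a villa, that is, a `t`-villa for some `t ≥ 3`. -/
def IsVilla (G : SimpleGraph V) : Prop :=
  ∃ t : ℕ, 3 ≤ t ∧ ∃ (A : Set V) (B C : Fin t → Set V),
    IsVillaPartitionOn G Set.univ A B C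

/-- For `t ≥ 3`: `(A; B₁, …, Bₜ; C₁, …, Cₜ; F; X; Y)` is a `t`-mansion partition of `G`. -/
structure IsMansionPartition (G : SimpleGraph V) {t : ℕ}
    (A : Set V) (B C : Fin t → Set V) (F X Y : Set V) : Prop where
  disjoint_F_X : Disjoint F X
  disjoint_F_Y : Disjoint F Y
  disjoint_X_Y : Disjoint X Y
  villa : IsVillaPartitionOn G (F ∪ X ∪ Y)ᶜ A B C
  nonempty_F : F.Nonempty
  clique_F : G.IsClique F
  clique_X : G.IsClique X
  clique_Y : G.IsClique Y
  special : ∃ j₀ : Fin t,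
    G.IsCompleteBetween F A ∧
    (∀ i, i ≠ j₀ → G.IsCompleteBetween F (B i)) ∧
    (∀ i, i ≠ j₀ → G.IsCompleteBetween F (C i)) ∧
    IsAnticompleteBetween G F (B j₀ ∪ C j₀) ∧
    G.IsCompleteBetween (B j₀) (C j₀) ∧
    G.IsCompleteBetween X (A ∪ B j₀) ∧
    (∀ i, i ≠ j₀ → IsAnticompleteBetween G X (B i)) ∧
    (∀ i, IsAnticompleteBetween G X (C i))
  F_complete : G.IsCompleteBetween F (X ∪ Y)
  X_anticomplete_Y : IsAnticompleteBetween G X Y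
  Y_complete_C : ∀ i, G.IsCompleteBetween Y (C i)
  Y_anticomplete_A : IsAnticompleteBetween G Y A
  Y_anticomplete_B : ∀ i, IsAnticompleteBetween G Y (B i)

/-- `G` is a mansion, that is, a `t`-mansion for some `t ≥ 3`. -/
def IsMansion (G : SimpleGraph V) : Prop :=
  ∃ t : ℕ, 3 ≤ t ∧ ∃ (A : Set V) (B C : Fin t → Set V) (F X Y : Set V),
    IsMansionPartition G A B C F X Y

end FiveHoled

/-! Assume that no vertex is simplicial and none is universal. The lever is
`Admissible.exists_simplicial`: a set of vertices that is a clique and whose outside neighbors form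
a clique must be empty. Around a fixed pentagon, each vertex has a type, namely its closed
neighborhood in the pentagon. The forbidden subgraphs rule out most types at once. Of the remaining
ones, several form cliques with clique outer neighborhoods, so they are empty as well; exclusion of
`T0` is needed only there, to control the neighbors of such vertices.

The proof then splits on whether some induced 3-pentagon has a vertex of type R (seeing only some
b_i and c_i) or A' (seeing a and the two other b's). If so, this vertex forces the remaining
adjacencies, and the types present are exactly the parts of a 5-basket (`basket_cases`,
`isFiveBasket_of_R_or_A'`).

If not, take a t-pentagon with t maximal. A vertex missing all b's and c's would allow an extension
to a (t+1)-pentagon (`exists_far_near_Y`), so every vertex has one of the types A, B_l, X_l, C_l, Y,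
F_l, U (`villa_cases`). Vertices of type U would be universal. Vertices of type X_l with a neighbor
of type C_l join B_l, and vertices of type Y with a neighbor of type B_l join C_l. If there is no F,
an X or Y left over would produce a simplicial vertex, and the graph is a villa. If there is an F,
all F vertices have one index r, and F, the vertices of type X_r and the remaining Y are the
additional parts of a mansion.

The nested orderings come from `C₄`-freeness: the neighborhoods of two vertices of a clique in
another clique are comparable. -/

namespace FiveHoled

variable {V : Type*}

/-! ### From forbidden induced subgraphs to closed adjacency -/

/-- The reflexive closure of the adjacency relation. -/
def Near (G : SimpleGraph V) (v w : V) : Prop := v = w ∨ G.Adj v w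

/-- A reflexive symmetric relation whose underlying graph is `(2P₃, C₄, C₆, C₇, T₀)`-free. As none
of these graphs has two adjacent vertices with the same closed neighborhood, no distinctness
assumptions on the vertices are needed. -/
structure Admissible (E : V → V → Prop) : Prop where
  refl : ∀ x, E x x
  symm : ∀ x y, E x y ↔ E y x
  C4 : ∀ x₁ x₂ x₃ x₄, ¬E x₁ x₂ ∨ ¬E x₂ x₃ ∨ ¬E x₃ x₄ ∨ ¬E x₄ x₁ ∨ E x₁ x₃ ∨ E x₂ x₄
  C6 : ∀ x₁ x₂ x₃ x₄ x₅ x₆,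
    ¬E x₁ x₂ ∨ ¬E x₂ x₃ ∨ ¬E x₃ x₄ ∨ ¬E x₄ x₅ ∨ ¬E x₅ x₆ ∨ ¬E x₆ x₁ ∨
    E x₁ x₃ ∨ E x₁ x₄ ∨ E x₁ x₅ ∨ E x₂ x₄ ∨ E x₂ x₅ ∨ E x₂ x₆ ∨ E x₃ x₅ ∨ E x₃ x₆ ∨ E x₄ x₆
  C7 : ∀ x₁ x₂ x₃ x₄ x₅ x₆ x₇,
    ¬E x₁ x₂ ∨ ¬E x₂ x₃ ∨ ¬E x₃ x₄ ∨ ¬E x₄ x₅ ∨ ¬E x₅ x₆ ∨ ¬E x₆ x₇ ∨ ¬E x₇ x₁ ∨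
    E x₁ x₃ ∨ E x₁ x₄ ∨ E x₁ x₅ ∨ E x₁ x₆ ∨ E x₂ x₄ ∨ E x₂ x₅ ∨ E x₂ x₆ ∨ E x₂ x₇ ∨
    E x₃ x₅ ∨ E x₃ x₆ ∨ E x₃ x₇ ∨ E x₄ x₆ ∨ E x₄ x₇ ∨ E x₅ x₇
  PP : ∀ x₁ x₂ x₃ y₁ y₂ y₃,
    ¬E x₁ x₂ ∨ ¬E x₂ x₃ ∨ E x₁ x₃ ∨ ¬E y₁ y₂ ∨ ¬E y₂ y₃ ∨ E y₁ y₃ ∨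
    E x₁ y₁ ∨ E x₁ y₂ ∨ E x₁ y₃ ∨ E x₂ y₁ ∨ E x₂ y₂ ∨ E x₂ y₃ ∨ E x₃ y₁ ∨ E x₃ y₂ ∨ E x₃ y₃
  T0 : ∀ a₀ a₁ b₀ b₁ b₂ b₃ c₁ c₂ c₃,
    ¬E a₀ a₁ ∨ ¬E a₀ b₀ ∨ ¬E a₁ b₁ ∨ ¬E a₀ b₂ ∨ ¬E a₀ b₃ ∨ ¬E a₁ b₂ ∨ ¬E a₁ b₃ ∨
    ¬E b₀ c₁ ∨ ¬E b₁ c₁ ∨ ¬E b₂ c₂ ∨ ¬E b₃ c₃ ∨ ¬E c₁ c₂ ∨ ¬E c₁ c₃ ∨ ¬E c₂ c₃ ∨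
    E a₀ b₁ ∨ E a₀ c₁ ∨ E a₀ c₂ ∨ E a₀ c₃ ∨ E a₁ b₀ ∨ E a₁ c₁ ∨ E a₁ c₂ ∨ E a₁ c₃ ∨
    E b₀ b₁ ∨ E b₀ b₂ ∨ E b₀ b₃ ∨ E b₀ c₂ ∨ E b₀ c₃ ∨ E b₁ b₂ ∨ E b₁ b₃ ∨ E b₁ c₂ ∨ E b₁ c₃ ∨
    E b₂ b₃ ∨ E b₂ c₁ ∨ E b₂ c₃ ∨ E b₃ c₁ ∨ E b₃ c₂

theorem near_symm (G : SimpleGraph V) (x y : V) : Near G x y ↔ Near G y x := by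
  simp only [Near, G.adj_comm, eq_comm]

/-- A map that respects closed adjacency shows induced containment of a graph without two vertices
with the same closed neighborhood. -/
theorem isIndContained_of_near {W : Type*} {H : SimpleGraph W} {G : SimpleGraph V} (f : W → V)
    (hH : ∀ i j, i ≠ j → ∃ k, ¬(Near H i k ↔ Near H j k))
    (hf : ∀ i j, i ≠ j → (Near G (f i) (f j) ↔ H.Adj i j)) : H.IsIndContained G := by
  have hf' : ∀ i j, Near G (f i) (f j) ↔ Near H i j := fun i j => by
    by_cases h : i = j
    · simp [Near, h]
    · rw [hf i j h]; simp [Near, h]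
  have hinj : Function.Injective f := fun i j hij => by
    by_contra h
    obtain ⟨k, hk⟩ := hH i j h
    exact hk (by rw [← hf', ← hf', hij])
  exact ⟨⟨f, hinj⟩, fun {i j} => by
    by_cases h : i = j
    · simp [h]
    · rw [← hf i j h]; simp [Near, hinj.ne h]⟩

theorem isIndContained_of_near_lt {n : ℕ} {H : SimpleGraph (Fin n)} {G : SimpleGraph V}
    (f : Fin n → V) (hH : ∀ i j, i ≠ j → ∃ k, ¬(Near H i k ↔ Near H j k))
    (hf : ∀ i j, i < j → (Near G (f i) (f j) ↔ H.Adj i j)) : H.IsIndContained G :=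
  isIndContained_of_near f hH fun i j h => by
    rcases lt_or_gt_of_ne h with h | h
    · exact hf i j h
    · rw [near_symm, H.adj_comm]; exact hf j i h

instance {W : Type*} [DecidableEq W] (H : SimpleGraph W) [DecidableRel H.Adj] :
    DecidableRel (Near H) := fun i j => inferInstanceAs (Decidable (i = j ∨ H.Adj i j))

instance : DecidableRel T0.Adj := fun i j =>
  decidable_of_iff (s(i, j) ∈ ({s(0, 1), s(0, 2), s(1, 3), s(0, 4), s(0, 5), s(1, 4), s(1, 5),
    s(2, 6), s(3, 6), s(4, 7), s(5, 8), s(6, 7), s(6, 8), s(7, 8)} : Finset (Sym2 (Fin 9))) ∧ i ≠ j)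
    (by simp [T0, SimpleGraph.fromEdgeSet_adj])

instance : DecidableRel twoP3.Adj := fun i j =>
  match i, j with
  | .inl i, .inl j => decidable_of_iff (i.val + 1 = j.val ∨ j.val + 1 = i.val)
    (by simp [twoP3, SimpleGraph.pathGraph_adj])
  | .inr i, .inr j => decidable_of_iff (i.val + 1 = j.val ∨ j.val + 1 = i.val)
    (by simp [twoP3, SimpleGraph.pathGraph_adj])
  | .inl _, .inr _ => isFalse (by simp [twoP3])
  | .inr _, .inl _ => isFalse (by simp [twoP3])

theorem admissible_near {G : SimpleGraph V} (h2P3 : IndFree twoP3 G)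
    (hC4 : IndFree (SimpleGraph.cycleGraph 4) G) (hC6 : IndFree (SimpleGraph.cycleGraph 6) G)
    (hC7 : IndFree (SimpleGraph.cycleGraph 7) G) (hT0 : IndFree T0 G) : Admissible (Near G) where
  refl _ := Or.inl rfl
  symm := near_symm G
  C4 x₁ x₂ x₃ x₄ := by
    have hs := near_symm G
    by_contra! h
    refine hC4 (isIndContained_of_near_lt ![x₁, x₂, x₃, x₄] (by decide) ?_)
    intro i j hij
    -- Each pair is tried as an edge of the cycle, then as a nonedge; the fields of `h` list the
    -- edges as true and the chords as false.
    fin_cases i <;> fin_cases j <;> first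
      | exact absurd hij (by decide)
      | exact iff_of_true (by simp; grind only) (by decide)
      | exact iff_of_false (by simp; grind only) (by decide)
  C6 x₁ x₂ x₃ x₄ x₅ x₆ := by
    have hs := near_symm G
    by_contra! h
    refine hC6 (isIndContained_of_near_lt ![x₁, x₂, x₃, x₄, x₅, x₆] (by decide) ?_)
    intro i j hij
    fin_cases i <;> fin_cases j <;> first
      | exact absurd hij (by decide)
      | exact iff_of_true (by simp; grind only) (by decide)
      | exact iff_of_false (by simp; grind only) (by decide)
  C7 x₁ x₂ x₃ x₄ x₅ x₆ x₇ := by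
    have hs := near_symm G
    by_contra! h
    refine hC7 (isIndContained_of_near_lt ![x₁, x₂, x₃, x₄, x₅, x₆, x₇] (by decide) ?_)
    intro i j hij
    fin_cases i <;> fin_cases j <;> first
      | exact absurd hij (by decide)
      | exact iff_of_true (by simp; grind only) (by decide)
      | exact iff_of_false (by simp; grind only) (by decide)
  PP x₁ x₂ x₃ y₁ y₂ y₃ := by
    have hs := near_symm G
    by_contra! h
    refine h2P3 (isIndContained_of_near (Sum.elim ![x₁, x₂, x₃] ![y₁, y₂, y₃]) (by decide) ?_)
    intro i j hij
    fin_cases i <;> fin_cases j <;> first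
      | exact absurd hij (by decide)
      | exact iff_of_true (by simp; grind only) (by decide)
      | exact iff_of_false (by simp; grind only) (by decide)
  T0 a₀ a₁ b₀ b₁ b₂ b₃ c₁ c₂ c₃ := by
    have hs := near_symm G
    by_contra! h
    refine hT0 (isIndContained_of_near_lt ![a₀, a₁, b₀, b₁, b₂, b₃, c₁, c₂, c₃] (by decide) ?_)
    intro i j hij
    fin_cases i <;> fin_cases j <;> first
      | exact absurd hij (by decide)
      | exact iff_of_true (by simp; grind only) (by decide)
      | exact iff_of_false (by simp; grind only) (by decide)

end FiveHoled

/-! ### Simplicial vertices, pentagon frames and vertex types -/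

namespace FiveHoled

variable {V ι : Type*} {E : V → V → Prop}

/-- The closed neighborhood of `v` is a clique. -/
def Simplicial (E : V → V → Prop) (v : V) : Prop := ∀ x y, E v x → E v y → E x y

/-- In a `C₄`-free graph, a nonempty clique whose outer neighborhood is a clique contains a
simplicial vertex. -/
theorem Admissible.exists_simplicial [Finite V] (h : Admissible E) {K : V → Prop} (hne : ∃ v, K v)
    (hK : ∀ v w, K v → K w → E v w)
    (hN : ∀ v w x y, K v → K w → ¬K x → ¬K y → E v x → E w y → E x y) : ∃ v, Simplicial E v := by
  obtain ⟨v, hv, hmin⟩ := Set.exists_min_image {v | K v} (fun v => {x | E v x}.ncard)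
    (Set.toFinite _) hne
  refine ⟨v, ?_⟩
  -- As `v` has the smallest closed neighborhood in `K`, all of `K` sees every outside neighbor of
  -- `v`; then the closed neighborhood of `v` is a clique.
  have key : ∀ x y, K x → ¬K y → E v y → E x y := by
    intro x y hx hy hvy
    by_contra hxy
    have hsub : {z | E x z} ⊂ {z | E v z} := by
      refine ⟨fun z hxz => ?_, fun hle => hxy (hle hvy)⟩
      by_contra hvz
      replace hxz : E x z := hxz
      replace hvz : ¬E v z := hvz
      have hz : ¬K z := fun hz => hvz (hK v z hv hz)
      -- A neighbor `z` of `x` missed by `v` would close an induced four-cycle `v x z y`, since the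
      -- outside neighbors `y` and `z` are adjacent.
      have := h.C4 v x z y
      have := hN v x y z hv hx hy hz hvy hxz
      have := hK v x hv hx
      grind only [h.symm]
    exact absurd (hmin x hx) (not_le.mpr (Set.ncard_lt_ncard hsub (Set.toFinite _)))
  intro x y hx hy
  by_cases hKx : K x <;> by_cases hKy : K y
  · exact hK x y hKx hKy
  · exact key x y hKx hKy hy
  · exact (h.symm _ _).1 (key y x hKy hKx hx)
  · exact hN v v x y hv hv hKx hKy hx hy

/-- A vertex `a` and two families of vertices `b`, `c`. -/
structure Frame (ι V : Type*) where
  a : V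
  b : ι → V
  c : ι → V

namespace Frame

variable {p : Frame ι V}

/-- The vertices of the frame induce a pentagon. -/
structure IsPentagon (p : Frame ι V) (E : V → V → Prop) : Prop where
  ab : ∀ i, E p.a (p.b i)
  ac : ∀ i, ¬E p.a (p.c i)
  bb : ∀ i j, i ≠ j → ¬E (p.b i) (p.b j)
  cc : ∀ i j, E (p.c i) (p.c j)
  bc : ∀ i, E (p.b i) (p.c i)
  bc_ne : ∀ i j, i ≠ j → ¬E (p.b i) (p.c j)

/-- The closed neighborhood of `v` in the frame is given by `α`, `β` and `γ`. -/
def HasType (p : Frame ι V) (E : V → V → Prop) (v : V) (α : Prop) (β γ : ι → Prop) : Prop :=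
  (E v p.a ↔ α) ∧ ∀ l, (E v (p.b l) ↔ β l) ∧ (E v (p.c l) ↔ γ l)

theorem HasType.at {v : V} {α : Prop} {β γ : ι → Prop} (hv : p.HasType E v α β γ) (i j k : ι) :
    (E v p.a ↔ α) ∧ ((E v (p.b i) ↔ β i) ∧ (E v (p.c i) ↔ γ i)) ∧
      ((E v (p.b j) ↔ β j) ∧ (E v (p.c j) ↔ γ j)) ∧ ((E v (p.b k) ↔ β k) ∧ (E v (p.c k) ↔ γ k)) :=
  ⟨hv.1, hv.2 i, hv.2 j, hv.2 k⟩

variable (p) (E)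

/-! The possible types of a vertex, by its closed neighborhood in the frame. -/

def IsX (i : ι) (v : V) : Prop := p.HasType E v True (· = i) (fun _ => False)
def IsR (i : ι) (v : V) : Prop := p.HasType E v False (· = i) (· = i)
def IsB (i : ι) (v : V) : Prop := p.HasType E v True (· = i) (· = i)
def IsA (v : V) : Prop := p.HasType E v True (fun _ => True) (fun _ => False)
def IsA' (i : ι) (v : V) : Prop := p.HasType E v True (· ≠ i) (fun _ => False)
def IsF (i : ι) (v : V) : Prop := p.HasType E v True (· ≠ i) (· ≠ i)
def IsY (v : V) : Prop := p.HasType E v False (fun _ => False) (fun _ => True)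
def IsC (i : ι) (v : V) : Prop := p.HasType E v False (· = i) (fun _ => True)
def IsU (v : V) : Prop := p.HasType E v True (fun _ => True) (fun _ => True)

variable {p} {E}

/-- With these adjacencies, symmetry and a list of instances of the forbidden subgraphs, each local
lemma below becomes propositional. The instances listed are its certificate. -/
theorem IsPentagon.facts (hp : p.IsPentagon E) {i j k : ι}
    (hd : i ≠ j ∧ i ≠ k ∧ j ≠ k) :
    i ≠ j ∧ i ≠ k ∧ j ≠ k ∧
    E p.a (p.b i) ∧ E p.a (p.b j) ∧ E p.a (p.b k) ∧
    ¬E p.a (p.c i) ∧ ¬E p.a (p.c j) ∧ ¬E p.a (p.c k) ∧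
    ¬E (p.b i) (p.b j) ∧ ¬E (p.b i) (p.b k) ∧ ¬E (p.b j) (p.b k) ∧
    E (p.c i) (p.c j) ∧ E (p.c i) (p.c k) ∧ E (p.c j) (p.c k) ∧
    E (p.b i) (p.c i) ∧ E (p.b j) (p.c j) ∧ E (p.b k) (p.c k) ∧
    ¬E (p.b i) (p.c j) ∧ ¬E (p.b i) (p.c k) ∧ ¬E (p.b j) (p.c i) ∧ ¬E (p.b j) (p.c k) ∧
    ¬E (p.b k) (p.c i) ∧ ¬E (p.b k) (p.c j) :=
  have ⟨hij, hik, hjk⟩ := hd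
  ⟨hij, hik, hjk, hp.ab i, hp.ab j, hp.ab k, hp.ac i, hp.ac j, hp.ac k, hp.bb _ _ hij, hp.bb _ _ hik,
    hp.bb _ _ hjk, hp.cc i j, hp.cc i k, hp.cc j k, hp.bc i, hp.bc j, hp.bc k, hp.bc_ne _ _ hij,
    hp.bc_ne _ _ hik, hp.bc_ne _ _ hij.symm, hp.bc_ne _ _ hjk, hp.bc_ne _ _ hik.symm,
    hp.bc_ne _ _ hjk.symm⟩

end Frame
end FiveHoled

/-! ### Local adjacency rules around three branches of a pentagon -/

namespace FiveHoled.Frame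

variable {V ι : Type*} {E : V → V → Prop} {p : Frame ι V}

section

variable (h : Admissible E) (hp : p.IsPentagon E) {i j k : ι} (hd : i ≠ j ∧ i ≠ k ∧ j ≠ k)
include h hp hd

theorem b_of_a_c (v : V) (hva : E v p.a) (hvc1 : E v (p.c i)) : E v (p.b i) := by
  grind only [h.symm, hp.facts hd, h.C4 v p.a (p.b i) (p.c i)]

theorem c_of_b_c (v : V) (hvb1 : E v (p.b i)) (hvc2 : E v (p.c j)) : E v (p.c i) := by
  grind only [h.symm, hp.facts hd, h.C4 (p.b i) v (p.c j) (p.c i)]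

theorem a_of_b_b (v : V) (hvb1 : E v (p.b i)) (hvb2 : E v (p.b j)) : E v p.a := by
  grind only [h.symm, hp.facts hd, h.C4 (p.b i) p.a (p.b j) v]

theorem c_of_not_a (v : V) (hva : ¬E v p.a) (hvb1 : E v (p.b i)) (hvc2 : E v (p.c j)) : E v (p.c k)
    := by
  grind only [h.symm, hp.facts hd, h.C6 (p.c j) v (p.b i) p.a (p.b k) (p.c k), h.C4 (p.b i) p.a (p.b
    k) v]

theorem near_of_common_b (x y : V) (hxb1 : E x (p.b i)) (hxb2 : E x (p.b j)) (hyb1 : E y (p.b i))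
    (hyb2 : E y (p.b j)) : E x y := by
  grind only [h.symm, hp.facts hd, h.C4 (p.b i) x (p.b j) y]

/-- The cycle b_k, c_k, c_j, b_j, x, b_i, y has length seven. If `x` and `y` are not adjacent, it
must have another chord, and every such chord leads to an induced `C₄` or `C₆`. -/
theorem near_of_b_b (x y : V) (hxb1 : E x (p.b i)) (hxb2 : E x (p.b j)) (hyb1 : E y (p.b i)) (hyb3 :
    E y (p.b k)) : E x y := by
  grind only [h.symm, hp.facts hd, h.C4 (p.b i) p.a (p.b j) x, h.C4 y (p.b k) p.a (p.b i), h.C7 (p.b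
    k) (p.c k) (p.c j) (p.b j) x (p.b i) y, h.C4 x p.a y (p.c i), h.C4 (p.b k) x (p.b i) y, h.C4 x
    (p.b j) y (p.b i), h.C4 p.a (p.b k) (p.c k) x, h.C4 (p.b i) (p.c i) (p.c k) y, h.C6 x (p.c j)
    (p.c k) (p.b k) y (p.b i), h.C4 p.a (p.b j) (p.c j) y, h.C4 x (p.b i) (p.c i) (p.c j), h.C6 x
    (p.b i) y (p.c k) (p.c j) (p.b j)]

theorem near_of_common_b_c (x y : V) (hxb1 : E x (p.b i)) (hxc2 : E x (p.c j)) (hyb1 : E y (p.b i))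
    (hyc2 : E y (p.c j)) : E x y := by
  grind only [h.symm, hp.facts hd, h.C4 x (p.b i) y (p.c j)]

/-- Vertices that see b_i but neither a nor c_i. This lemma and the next three supply the two clique
conditions of `Admissible.exists_simplicial`, so that `c_of_not_a_b` can exclude them. -/
theorem Q_near_Q (x y : V) (hxa : ¬E x p.a) (hxb1 : E x (p.b i)) (hxc1 : ¬E x (p.c i)) (hya : ¬E y
    p.a) (hyb1 : E y (p.b i)) (hyc1 : ¬E y (p.c i)) : E x y := by
  grind only [h.symm, hp.facts hd, h.PP (p.c k) (p.c j) (p.b j) y (p.b i) x, h.C4 (p.c j) (p.c i)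
    (p.b i) x, h.C4 y (p.c j) (p.c i) (p.b i), h.C4 y (p.b i) (p.c i) (p.c k), h.C4 (p.c k) x (p.b
    i) (p.c i), h.C4 x (p.b i) p.a (p.b j), h.C4 (p.b i) p.a (p.b j) y]

theorem b_of_near_Q (v x : V) (hva : ¬E v p.a) (hvb1 : E v (p.b i)) (hvc1 : ¬E v (p.c i)) (hvx : E v
    x) : E x (p.b i) := by
  grind only [h.symm, hp.facts hd, h.C4 v (p.c k) (p.c i) (p.b i), h.C4 v x (p.c i) (p.b i), h.C4 v
    (p.b i) (p.c i) (p.c j), h.C4 v x p.a (p.b i), h.C4 v (p.b i) p.a (p.b j), h.C4 v (p.b i) p.a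
    (p.b k), h.C4 (p.b k) x (p.b j) p.a, h.C6 (p.c k) (p.c i) (p.b i) p.a (p.b j) x, h.PP (p.b k)
    (p.c k) (p.c i) v x (p.b j), h.C7 (p.c j) (p.c k) x v (p.b i) p.a (p.b j), h.PP x v (p.b i) (p.c
    k) (p.c j) (p.b j), h.C6 (p.b i) v x (p.c j) (p.b j) p.a]

theorem not_c_of_near_Q (v x : V) (hva : ¬E v p.a) (hvb1 : E v (p.b i)) (hvc1 : ¬E v (p.c i)) (hvx :
    E v x) (hxa : ¬E x p.a) : ¬E x (p.c i) := by
  grind only [h.symm, hp.facts hd, h.C4 (p.b i) (p.c i) x v, h.PP (p.b k) p.a (p.b j) (p.c i) x v,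
    h.C4 v (p.b k) p.a (p.b i), h.C4 v (p.b j) p.a (p.b i), h.C4 (p.b i) x (p.b k) p.a, h.C4 x (p.b
    i) p.a (p.b j)]

theorem near_Q_cases (v w x : V) (hva : ¬E v p.a) (hvb1 : E v (p.b i)) (hwa : ¬E w p.a) (hwb1 : E w
    (p.b i)) (hwc1 : ¬E w (p.c i)) (hvx : E v x) (hxa : E x p.a) : E w x ∨ E x (p.b j) ∨ E x (p.b k)
    := by
  grind only [h.symm, hp.facts hd, h.C4 v x p.a (p.b i), h.PP w (p.b i) x (p.b j) (p.c j) (p.c k),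
    h.C4 w (p.c j) (p.c i) (p.b i), h.C4 w (p.c k) (p.c i) (p.b i), h.C4 w (p.b i) p.a (p.b j), h.C4
    x (p.c k) (p.b k) p.a, h.C4 p.a x (p.c j) (p.b j)]

/-- Vertices that see c_i but neither b_i nor c_j, c_k. Two nonadjacent ones form with c_i a path
which, against b_k, a, b_j, yields `2P₃` unless an extra edge creates a `C₄`. The lemmas up to
`c_iff_c_of_near_D` describe their neighbors, for use in `c_of_c_of_not_b`. -/
theorem D_near_D (x y : V) (hxb1 : ¬E x (p.b i)) (hxc1 : E x (p.c i)) (hxc2 : ¬E x (p.c j)) (hxc3 :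
    ¬E x (p.c k)) (hyb1 : ¬E y (p.b i)) (hyc1 : E y (p.c i)) (hyc2 : ¬E y (p.c j)) (hyc3 : ¬E y (p.c
    k)) : E x y := by
  grind only [h.symm, hp.facts hd, h.PP x (p.c i) y (p.b k) p.a (p.b j), h.C4 y (p.b k) (p.c k) (p.c
    i), h.C4 y (p.b j) (p.c j) (p.c i), h.C4 y p.a (p.b i) (p.c i), h.C4 (p.b j) (p.c j) (p.c i) x,
    h.C4 (p.c k) (p.b k) x (p.c i), h.C4 x (p.c i) (p.b i) p.a]

theorem b_of_near_D_of_a (v x : V) (hvb1 : ¬E v (p.b i)) (hvc1 : E v (p.c i)) (hvc2 : ¬E v (p.c j))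
    (hvc3 : ¬E v (p.c k)) (hvx : E v x) (hxa : E x p.a) : E x (p.b i) := by
  grind only [h.symm, hp.facts hd, h.C6 (p.b j) (p.c j) (p.c i) v x p.a, h.C4 p.a v (p.c i) (p.b i),
    h.C4 x p.a (p.b i) (p.c i), h.C4 (p.b j) v (p.c i) (p.c j), h.C4 v (p.b k) (p.c k) (p.c i), h.C4
    x (p.c k) (p.c i) v, h.C4 (p.c j) x v (p.c i), h.C6 (p.b k) (p.c k) (p.c i) v x p.a, h.T0 p.a x
    (p.b i) v (p.b j) (p.b k) (p.c i) (p.c j) (p.c k)]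

theorem b_or_b_of_near_D (v x : V) (hvb1 : ¬E v (p.b i)) (hvc1 : E v (p.c i)) (hvc2 : ¬E v (p.c j))
    (hvc3 : ¬E v (p.c k)) (hvx : E v x) (hxa : E x p.a) : E x (p.b j) ∨ E x (p.b k) := by
  grind only [h.symm, hp.facts hd, h.C6 (p.c j) (p.b j) p.a x v (p.c i), h.C4 v p.a (p.b i) (p.c i),
    h.C4 v (p.b j) (p.c j) (p.c i), h.C4 (p.c j) (p.b j) p.a x, h.C4 (p.c k) (p.b k) p.a x, h.C4
    (p.b i) (p.c i) x p.a, h.PP v x (p.b i) (p.c k) (p.c j) (p.b j)]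

theorem c_of_near_D (v x : V) (hvb1 : ¬E v (p.b i)) (hvc1 : E v (p.c i)) (hvc2 : ¬E v (p.c j)) (hvc3
    : ¬E v (p.c k)) (hvx : E v x) : E x (p.c i) := by
  grind only [h.symm, hp.facts hd, h.PP (p.c i) v x (p.b j) p.a (p.b k), h.C4 v x (p.b i) (p.c i),
    h.C4 v p.a (p.b i) (p.c i), h.C4 v (p.b j) (p.c j) (p.c i), h.C4 v x (p.c j) (p.c i), h.C4 v x
    (p.c k) (p.c i), h.C4 v (p.b k) (p.c k) (p.c i), h.T0 x p.a v (p.b i) (p.b k) (p.b j) (p.c i)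
    (p.c k) (p.c j), h.C6 (p.c k) (p.c i) v x p.a (p.b k), h.C6 (p.b j) (p.c j) (p.c i) v x p.a,
    h.C7 (p.c j) (p.b j) p.a (p.b k) x v (p.c i), h.C6 (p.c i) (p.b i) p.a (p.b j) x v]

theorem c_or_c_of_near_D (v x : V) (hvb1 : ¬E v (p.b i)) (hvc1 : E v (p.c i)) (hvc2 : ¬E v (p.c j))
    (hvc3 : ¬E v (p.c k)) (hvx : E v x) (hxb1 : E x (p.b i)) : E x (p.c j) ∨ E x (p.c k) := by
  grind only [h.symm, hp.facts hd, h.C4 x (p.b i) (p.c i) v, h.PP (p.b i) x v (p.b j) (p.c j) (p.c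
    k), h.C4 (p.c j) (p.c i) v (p.b j), h.C4 (p.c j) (p.c i) x (p.b j)]

theorem c_iff_c_of_near_D (v x : V) (hvb1 : ¬E v (p.b i)) (hvc1 : E v (p.c i)) (hvc2 : ¬E v (p.c j))
    (hvc3 : ¬E v (p.c k)) (hvx : E v x) (hxa : ¬E x p.a) (hxc2 : E x (p.c j)) : E x (p.b i) := by
  grind only [h.symm, hp.facts hd, h.PP (p.c j) x v (p.b k) p.a (p.b i), h.C4 (p.c k) (p.b k) v (p.c
    i), h.C4 (p.b j) x (p.b k) p.a, h.C4 (p.b j) (p.c j) (p.c i) v, h.C4 p.a (p.b i) (p.c i) v, h.C4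
    (p.c k) (p.c j) x (p.b k), h.PP (p.b i) p.a (p.b j) v x (p.c k)]

/-- Vertices that see c_j and c_k but neither a nor c_i; they and their neighbors are treated here
for use in `c_of_c_of_c`. -/
theorem E_near_E (x y : V) (hxa : ¬E x p.a) (hxc1 : ¬E x (p.c i)) (hxc2 : E x (p.c j)) (hya : ¬E y
    p.a) (hyc1 : ¬E y (p.c i)) (hyc2 : E y (p.c j)) : E x y := by
  grind only [h.symm, hp.facts hd, h.PP x (p.c j) y (p.b i) p.a (p.b k), h.C4 (p.c i) (p.b i) x (p.c
    j), h.C4 y (p.c j) (p.c i) (p.b i), h.C6 y (p.b k) p.a (p.b i) (p.c i) (p.c j), h.C6 (p.c i)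
    (p.b i) p.a (p.b k) x (p.c j)]

theorem c_of_near_E (v x : V) (hva : ¬E v p.a) (hvc1 : ¬E v (p.c i)) (hvc2 : E v (p.c j)) (hvc3 : E
    v (p.c k)) (hvx : E v x) : E x (p.c j) := by
  grind only [h.symm, hp.facts hd, h.PP (p.b k) p.a (p.b i) x v (p.c j), h.C4 v (p.b i) (p.c i) (p.c
    k), h.C4 v x (p.c i) (p.c j), h.C4 x (p.c k) (p.c i) (p.b i), h.C4 (p.b k) (p.c k) v x, h.C6
    (p.b j) v (p.c k) (p.c i) (p.b i) p.a, h.C4 (p.b j) x v (p.c j), h.C6 (p.c j) (p.c i) (p.b i)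
    p.a (p.b k) v, h.T0 (p.c k) (p.c j) (p.b k) (p.b j) v (p.c i) p.a x (p.b i), h.C6 (p.c j) (p.b
    j) p.a (p.b k) x v, h.C6 (p.b k) (p.c k) v x (p.b i) p.a, h.C6 (p.b i) p.a x v (p.c j) (p.c i)]

theorem b_of_near_E (v x : V) (hva : ¬E v p.a) (hvc1 : ¬E v (p.c i)) (hvc2 : E v (p.c j)) (hvc3 : E
    v (p.c k)) (hvx : E v x) (hxa : E x p.a) : E x (p.b j) := by
  grind only [h.symm, hp.facts hd, h.C6 (p.c j) v x p.a (p.b i) (p.c i), h.C4 v (p.b i) (p.c i) (p.c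
    j), h.C4 v x p.a (p.b j), h.C4 p.a x (p.c j) (p.b j), h.C4 x v (p.c j) (p.c i), h.T0 (p.c k)
    (p.c j) (p.b k) (p.b j) (p.c i) v p.a (p.b i) x, h.C4 (p.c i) (p.b i) x (p.c k), h.C6 p.a (p.b
    i) (p.c i) (p.c j) v (p.b k), h.C4 (p.b k) x v (p.c k)]

theorem b_of_near_E' (v x : V) (hva : ¬E v p.a) (hvc1 : ¬E v (p.c i)) (hvc2 : E v (p.c j)) (hvc3 : E
    v (p.c k)) (hvx : E v x) (hxa : ¬E x p.a) (hxc1 : E x (p.c i)) : E x (p.b j) ∨ E x (p.b k) := by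
  grind only [h.symm, hp.facts hd, h.PP (p.c i) x v (p.b j) p.a (p.b k), h.C4 v (p.c k) (p.c i) (p.b
    i), h.C6 (p.b i) p.a (p.b j) v (p.c k) (p.c i), h.C6 p.a (p.b k) v (p.c j) (p.c i) (p.b i)]

theorem C_near_C_ne (x y : V) (hxb1 : E x (p.b i)) (hyb2 : E y (p.b j)) (hxb2 : ¬E x (p.b j)) (hyb1
    : ¬E y (p.b i)) (hxa : ¬E x p.a) (hya : ¬E y p.a) (hxc3 : E x (p.c k)) (hyc3 : E y (p.c k)) : E
    x y := by
  grind only [h.symm, hp.facts hd, h.C6 y (p.b j) p.a (p.b i) x (p.c k)]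

end

end FiveHoled.Frame

/-! ### Types excluded by the absence of simplicial vertices -/

namespace FiveHoled.Frame

variable {V ι : Type*} {E : V → V → Prop} {p : Frame ι V}

theorem c_of_not_a_b [Finite V] (h : Admissible E) (hp : p.IsPentagon E)
    (hs : ∀ v, ¬Simplicial E v) {i j k : ι} (hd : i ≠ j ∧ i ≠ k ∧ j ≠ k) {v : V}
    (hva : ¬E v p.a) (hvb : E v (p.b i)) : E v (p.c i) := by
  by_contra hvc
  obtain ⟨hij, hik, hjk⟩ := id hd
  have hd' : i ≠ k ∧ i ≠ j ∧ k ≠ j := ⟨hik, hij, hjk.symm⟩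
  refine not_exists.2 hs (h.exists_simplicial
    (K := fun x => ¬E x p.a ∧ E x (p.b i) ∧ ¬E x (p.c i)) ⟨v, hva, hvb, hvc⟩
    (fun x y hx hy => Q_near_Q h hp hd x y hx.1 hx.2.1 hx.2.2 hy.1 hy.2.1 hy.2.2) ?_)
  rintro v w x y ⟨hv, hv', hv''⟩ ⟨hw, hw', hw''⟩ hx hy hvx hwy
  have hxb := b_of_near_Q h hp hd v x hv hv' hv'' hvx
  have hyb := b_of_near_Q h hp hd w y hw hw' hw'' hwy
  have hxa : E x p.a := by
    by_contra hxa
    exact hx ⟨hxa, hxb, not_c_of_near_Q h hp hd v x hv hv' hv'' hvx hxa⟩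
  have hya : E y p.a := by
    by_contra hya
    exact hy ⟨hya, hyb, not_c_of_near_Q h hp hd w y hw hw' hw'' hwy hya⟩
  -- If `w` also sees `x`, then `w x a y` is a four-cycle and `w` misses a, so `x` and `y` are
  -- adjacent. By symmetry it remains to treat `x` and `y` that each see b_i and another b.
  rcases near_Q_cases h hp hd v w x hv hv' hw hw' hw'' hvx hxa with hwx | hx'
  · have := h.C4 w x p.a y
    grind only [h.symm]
  rcases near_Q_cases h hp hd w v y hw hw' hv hv' hv'' hwy hya with hvy | hy'
  · have := h.C4 v y p.a x
    grind only [h.symm]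
  have := near_of_common_b h hp hd x y hxb
  have := near_of_common_b h hp hd' x y hxb
  have := near_of_b_b h hp hd x y hxb
  have := near_of_b_b h hp hd' x y hxb
  grind only

theorem c_of_c_of_not_b [Finite V] (h : Admissible E) (hp : p.IsPentagon E)
    (hs : ∀ v, ¬Simplicial E v) {i j k : ι} (hd : i ≠ j ∧ i ≠ k ∧ j ≠ k) {v : V}
    (hvb : ¬E v (p.b i)) (hvc : E v (p.c i)) : E v (p.c j) ∨ E v (p.c k) := by
  by_contra! hvc'
  obtain ⟨hij, hik, hjk⟩ := id hd
  have hd' : i ≠ k ∧ i ≠ j ∧ k ≠ j := ⟨hik, hij, hjk.symm⟩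
  refine not_exists.2 hs (h.exists_simplicial
    (K := fun x => ¬E x (p.b i) ∧ E x (p.c i) ∧ ¬E x (p.c j) ∧ ¬E x (p.c k))
    ⟨v, hvb, hvc, hvc'⟩
    (fun x y hx hy => D_near_D h hp hd x y hx.1 hx.2.1 hx.2.2.1 hx.2.2.2 hy.1 hy.2.1 hy.2.2.1 hy.2.2.2)
    ?_)
  -- Any two outside neighbors now share b_i. If both see a, each sees two b's; otherwise they also
  -- share c_j or c_k. Either way they are adjacent.
  have key : ∀ v x, (¬E v (p.b i) ∧ E v (p.c i) ∧ ¬E v (p.c j) ∧ ¬E v (p.c k)) →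
      ¬(¬E x (p.b i) ∧ E x (p.c i) ∧ ¬E x (p.c j) ∧ ¬E x (p.c k)) → E v x →
      E x (p.b i) ∧ (E x (p.c j) ∨ E x (p.c k)) ∧ (E x p.a → E x (p.b j) ∨ E x (p.b k)) ∧
      (¬E x p.a → E x (p.c j) ∧ E x (p.c k)) := by
    rintro v x ⟨h₁, h₂, h₃, h₄⟩ hx hvx
    have := c_of_near_D h hp hd v x h₁ h₂ h₃ h₄ hvx
    have := b_of_near_D_of_a h hp hd v x h₁ h₂ h₃ h₄ hvx
    have := b_or_b_of_near_D h hp hd v x h₁ h₂ h₃ h₄ hvx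
    have := c_or_c_of_near_D h hp hd v x h₁ h₂ h₃ h₄ hvx
    have := c_iff_c_of_near_D h hp hd v x h₁ h₂ h₃ h₄ hvx
    have := c_iff_c_of_near_D h hp hd' v x h₁ h₂ h₄ h₃ hvx
    have := c_of_not_a h hp hd x
    have := c_of_not_a h hp hd' x
    grind only
  intro v w x y hv hw hx hy hvx hwy
  have hx' := key v x hv hx hvx
  have hy' := key w y hw hy hwy
  have := near_of_common_b h hp hd x y
  have := near_of_common_b h hp hd' x y
  have := near_of_b_b h hp hd x y
  have := near_of_b_b h hp hd' x y
  have := near_of_common_b_c h hp hd x y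
  have := near_of_common_b_c h hp hd' x y
  grind only

theorem c_of_c_of_c [Finite V] (h : Admissible E) (hp : p.IsPentagon E)
    (hs : ∀ v, ¬Simplicial E v) {i j k : ι} (hd : i ≠ j ∧ i ≠ k ∧ j ≠ k) {v : V}
    (hva : ¬E v p.a) (hvj : E v (p.c j)) (hvk : E v (p.c k)) : E v (p.c i) := by
  by_contra hvc
  obtain ⟨hij, hik, hjk⟩ := id hd
  have hd' : i ≠ k ∧ i ≠ j ∧ k ≠ j := ⟨hik, hij, hjk.symm⟩
  have hd₁ : j ≠ k ∧ j ≠ i ∧ k ≠ i := ⟨hjk, hij.symm, hik.symm⟩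
  have hd₃ : k ≠ j ∧ k ≠ i ∧ j ≠ i := ⟨hjk.symm, hik.symm, hij.symm⟩
  refine not_exists.2 hs (h.exists_simplicial
    (K := fun x => ¬E x p.a ∧ ¬E x (p.c i) ∧ E x (p.c j) ∧ E x (p.c k))
    ⟨v, hva, hvc, hvj, hvk⟩
    (fun x y hx hy => E_near_E h hp hd x y hx.1 hx.2.1 hx.2.2.1 hy.1 hy.2.1 hy.2.2.1) ?_)
  -- Two outside neighbors share b_j and b_k, or a b and the opposite c, or they miss a and see
  -- different b's; the last case is `C_near_C_ne`, which rests on a six-cycle.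
  have key : ∀ v x, (¬E v p.a ∧ ¬E v (p.c i) ∧ E v (p.c j) ∧ E v (p.c k)) →
      ¬(¬E x p.a ∧ ¬E x (p.c i) ∧ E x (p.c j) ∧ E x (p.c k)) → E v x →
      E x (p.c j) ∧ E x (p.c k) ∧ (E x p.a → E x (p.b j) ∧ E x (p.b k)) ∧
      (¬E x p.a → E x (p.c i) ∧ (E x (p.b j) ∨ E x (p.b k))) := by
    rintro v x ⟨h₁, h₂, h₃, h₄⟩ hx hvx
    have := c_of_near_E h hp hd v x h₁ h₂ h₃ h₄ hvx
    have := c_of_near_E h hp hd' v x h₁ h₂ h₄ h₃ hvx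
    have := b_of_near_E h hp hd v x h₁ h₂ h₃ h₄ hvx
    have := b_of_near_E h hp hd' v x h₁ h₂ h₄ h₃ hvx
    have := b_of_near_E' h hp hd v x h₁ h₂ h₃ h₄ hvx
    grind only
  intro v w x y hv hw hx hy hvx hwy
  have hx' := key v x hv hx hvx
  have hy' := key w y hw hy hwy
  have := near_of_common_b h hp hd₁ x y
  have := near_of_common_b_c h hp hd₁ x y
  have := near_of_common_b_c h hp hd₃ x y
  have := C_near_C_ne h hp hd₁ x y
  have := C_near_C_ne h hp hd₃ x y
  have := a_of_b_b h hp hd₁ x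
  have := a_of_b_b h hp hd₁ y
  clear key
  grind +splitImp only

end FiveHoled.Frame

/-! ### Far vertices, and the consequences of a vertex of type R or A' -/

namespace FiveHoled.Frame

variable {V ι : Type*} {E : V → V → Prop} {p : Frame ι V}

section

variable (h : Admissible E) (hp : p.IsPentagon E) {i j k : ι} (hd : i ≠ j ∧ i ≠ k ∧ j ≠ k)
include h hp hd

/-- Otherwise the paths x, y, z and c_j, c_i, b_i form `2P₃`. -/
theorem far_trans (x y z : V) (hxb1 : ¬E x (p.b i)) (hxc1 : ¬E x (p.c i)) (hxc2 : ¬E x (p.c j))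
    (hyb1 : ¬E y (p.b i)) (hyc1 : ¬E y (p.c i)) (hyc2 : ¬E y (p.c j)) (hzb1 : ¬E z (p.b i)) (hzc1 :
    ¬E z (p.c i)) (hzc2 : ¬E z (p.c j)) (hxy : E x y) (hyz : E y z) : E x z := by
  grind only [h.symm, hp.facts hd, h.PP z y x (p.c j) (p.c i) (p.b i)]

theorem b_or_b_of_near_far (x y : V) (hxb1 : ¬E x (p.b i)) (hxb2 : ¬E x (p.b j)) (hxb3 : ¬E x (p.b
    k)) (hxc1 : ¬E x (p.c i)) (hxc2 : ¬E x (p.c j)) (hxc3 : ¬E x (p.c k)) (hxy : E x y) (hyb1 : E y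
    (p.b i)) : E y (p.b j) ∨ E y (p.b k) := by
  grind only [h.symm, hp.facts hd, h.PP (p.c k) (p.c j) (p.b j) x y (p.b i), h.C4 p.a (p.b j) (p.c
    j) y, h.C4 p.a (p.b k) (p.c k) y, h.C4 y (p.c k) (p.c i) (p.b i), h.C4 (p.c j) y (p.b i) (p.c
    i), h.PP x y (p.c i) (p.b j) p.a (p.b k), h.C4 x y (p.b i) p.a]

/-- Otherwise the paths b_k, a, b_j and c_i, y, x form `2P₃`. -/
theorem a_of_far_near_Y (x y : V) (hxb2 : ¬E x (p.b j)) (hxb3 : ¬E x (p.b k)) (hxc1 : ¬E x (p.c i))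
    (hya : ¬E y p.a) (hyb2 : ¬E y (p.b j)) (hyb3 : ¬E y (p.b k)) (hyc1 : E y (p.c i)) (hxy : E x y)
    : E x p.a := by
  grind only [h.symm, hp.facts hd, h.PP (p.b k) p.a (p.b j) (p.c i) y x]

/-- From here to `B_near_C_ne`, the vertex `w` supplies an additional induced path, and
`2P₃`-freeness then excludes types or forces adjacencies that a 3-pentagon alone does not. -/
theorem not_X (w x : V) (hw : p.IsR E i w ∨ p.IsA' E i w) (hxa : E x p.a) (hxb1 : E x (p.b i)) (hxb2
    : ¬E x (p.b j)) (hxb3 : ¬E x (p.b k)) : E x (p.c i) := by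
  rcases hw with hw | hw
  · grind only [h.symm, hp.facts hd, HasType.at hw i j k, h.PP w (p.c i) (p.c j) x p.a (p.b k), h.C4
      x (p.c j) (p.b j) p.a, h.C6 w (p.c i) (p.c j) (p.b j) p.a x]
  · grind only [h.symm, hp.facts hd, HasType.at hw i j k, h.PP (p.b j) w (p.b k) (p.c i) (p.b i) x,
      h.C6 (p.b j) w x (p.b i) (p.c i) (p.c j), h.C4 (p.b i) (p.c i) (p.c j) x]

theorem not_X_ne (w x : V) (hw : p.IsR E i w ∨ p.IsA' E i w) (hxa : E x p.a) (hxb2 : E x (p.b j))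
    (hxb1 : ¬E x (p.b i)) (hxb3 : ¬E x (p.b k)) : E x (p.c j) := by
  rcases hw with hw | hw
  · grind only [h.symm, hp.facts hd, HasType.at hw i j k, h.PP w (p.c i) (p.c j) x p.a (p.b k), h.C4
      p.a x w (p.b i), h.C4 p.a x (p.c i) (p.b i)]
  · grind only [h.symm, hp.facts hd, HasType.at hw i j k, h.PP (p.b i) (p.c i) (p.c k) x (p.b j) w,
      h.C4 (p.b j) (p.c j) (p.c k) x, h.C4 (p.c i) x p.a (p.b i), h.PP x w (p.b k) (p.b i) (p.c i)
      (p.c j)]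

theorem not_Y (w x : V) (hw : p.IsR E i w ∨ p.IsA' E i w) (hxa : ¬E x p.a) (hxb1 : ¬E x (p.b i))
    (hxb2 : ¬E x (p.b j)) (hxb3 : ¬E x (p.b k)) (hxc1 : E x (p.c i)) (hxc2 : E x (p.c j)) (hxc3 : E
    x (p.c k)) : False := by
  rcases hw with hw | hw
  · grind only [h.symm, hp.facts hd, HasType.at hw i j k, h.PP (p.b k) p.a (p.b j) x (p.c i) w, h.C6
      x (p.c j) (p.b j) p.a (p.b i) w]
  · grind only [h.symm, hp.facts hd, HasType.at hw i j k, h.PP (p.b k) w (p.b j) x (p.c i) (p.b i),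
      h.C4 x (p.c k) (p.b k) w]

theorem not_R_ne (w x : V) (hw : p.IsR E i w ∨ p.IsA' E i w) (hxa : ¬E x p.a) (hxb2 : E x (p.b j))
    (hxc2 : E x (p.c j)) : E x (p.c k) := by
  rcases hw with hw | hw
  · grind only [h.symm, hp.facts hd, HasType.at hw i j k, h.PP x (p.c j) (p.c k) w (p.b i) p.a, h.C4
      (p.b k) x (p.b j) p.a, h.C4 (p.b i) x (p.b j) p.a, h.C7 (p.c j) (p.c k) (p.b k) p.a (p.b i) w
      x]
  · grind only [h.symm, hp.facts hd, HasType.at hw i j k, h.PP x (p.b j) w (p.c k) (p.c i) (p.b i),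
      h.C4 p.a (p.b j) x (p.b i), h.C4 (p.b k) p.a (p.b j) x, h.C6 (p.c j) x w p.a (p.b i) (p.c i),
      h.C6 (p.b k) (p.c k) (p.c i) x (p.b j) p.a]

theorem not_A'_ne (w x : V) (hw : p.IsR E i w ∨ p.IsA' E i w) (hxb1 : E x (p.b i)) (hxb3 : E x (p.b
    k)) (hxb2 : ¬E x (p.b j)) : E x (p.c i) := by
  rcases hw with hw | hw
  · grind only [h.symm, hp.facts hd, HasType.at hw i j k, h.C4 (p.b k) p.a (p.b i) x, h.PP w (p.c i)
      (p.c k) (p.b j) p.a x, h.C4 (p.c j) x p.a (p.b j), h.C4 (p.c k) x (p.b i) (p.c i), h.C6 p.a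
      (p.b j) (p.c j) (p.c i) w x]
  · grind only [h.symm, hp.facts hd, HasType.at hw i j k, h.C7 (p.c j) (p.c i) (p.b i) x (p.b k) w
      (p.b j), h.C4 (p.b i) (p.c i) (p.c j) x, h.C6 (p.b i) (p.c i) (p.c j) (p.b j) w x]

theorem A_near_B_ne (w x y : V) (hw : p.IsR E i w ∨ p.IsA' E i w) (hxa : E x p.a) (hxb2 : E x (p.b
    j)) (hxb3 : E x (p.b k)) (hxc2 : ¬E x (p.c j)) (hya : E y p.a) (hyb2 : E y (p.b j)) (hyc2 : E y
    (p.c j)) (hyb1 : ¬E y (p.b i)) (hyb3 : ¬E y (p.b k)) : E x y := by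
  rcases hw with hw | hw
  · grind only [h.symm, hp.facts hd, HasType.at hw i j k, h.PP x p.a y w (p.c i) (p.c k), h.C4 (p.c
      k) x (p.b j) (p.c j), h.C4 y (p.c k) (p.b k) p.a, h.C4 (p.b j) (p.c j) (p.c i) x, h.C4 p.a y
      (p.c i) (p.b i), h.C4 p.a y w (p.b i), h.C6 (p.c i) w x p.a y (p.c j)]
  · grind only [h.symm, hp.facts hd, HasType.at hw i j k, h.C4 x (p.b k) w (p.b j), h.PP y (p.b j) w
      (p.b i) (p.c i) (p.c k), h.PP y (p.b j) x (p.b i) (p.c i) (p.c k), h.C4 (p.c i) (p.c j) (p.b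
      j) x, h.C4 (p.c i) (p.b i) p.a y, h.C4 (p.b k) (p.c k) y p.a, h.C4 (p.c k) (p.c j) (p.b j) x,
      h.C6 (p.c j) y w x (p.b i) (p.c i)]

theorem B_near_C (w x y : V) (hw : p.IsR E i w ∨ p.IsA' E i w) (hxb1 : E x (p.b i)) (hxc1 : E x (p.c
    i)) (hxb2 : ¬E x (p.b j)) (hxb3 : ¬E x (p.b k)) (hxc2 : ¬E x (p.c j)) (hxc3 : ¬E x (p.c k)) (hya
    : ¬E y p.a) (hyb1 : E y (p.b i)) (hyc1 : E y (p.c i)) (hyc2 : E y (p.c j)) (hyc3 : E y (p.c k))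
    : E x y := by
  rcases hw with hw | hw
  · grind only [h.symm, hp.facts hd, HasType.at hw i j k, h.PP (p.b k) p.a (p.b j) y (p.c i) w, h.PP
      (p.b j) (p.c j) (p.c k) w (p.b i) x, h.C4 (p.b i) y (p.b k) p.a, h.C4 (p.b i) y (p.b j) p.a,
      h.PP x w y (p.b j) p.a (p.b k), h.C6 (p.c k) y w x p.a (p.b k)]
  · grind only [h.symm, hp.facts hd, HasType.at hw i j k, h.PP y (p.c i) x (p.b k) w (p.b j), h.C4
      (p.b k) y (p.b i) p.a, h.C4 p.a (p.b j) y (p.b i), h.C6 (p.b j) (p.c j) y (p.b i) x w, h.C4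
      (p.b k) w y (p.c k)]

theorem B_near_C_ne (w x y : V) (hw : p.IsR E i w ∨ p.IsA' E i w) (hxa : E x p.a) (hxb2 : E x (p.b
    j)) (hxb1 : ¬E x (p.b i)) (hxb3 : ¬E x (p.b k)) (hya : ¬E y p.a) (hyb2 : E y (p.b j)) (hyc1 : E
    y (p.c i)) (hyc3 : E y (p.c k)) : E x y := by
  rcases hw with hw | hw
  · grind only [h.symm, hp.facts hd, HasType.at hw i j k, h.PP x p.a (p.b k) w (p.c i) y, h.C4 (p.b
      i) w x p.a, h.C4 (p.b i) (p.c i) x p.a, h.C4 (p.b i) y (p.b j) p.a, h.C4 y (p.b k) p.a (p.b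
      j), h.C6 w y (p.c k) (p.b k) p.a (p.b i)]
  · grind only [h.symm, hp.facts hd, HasType.at hw i j k, h.PP x (p.b j) w (p.c k) (p.c i) (p.b i),
      h.C4 y (p.b j) p.a (p.b i), h.C4 y (p.b j) p.a (p.b k), h.C4 y (p.b j) x (p.c i), h.C4 y (p.b
      j) x (p.c k), h.PP (p.b k) w x (p.b i) (p.c i) y, h.C4 (p.c k) (p.b k) w y]

theorem B_near_B (x y : V) (hxb1 : E x (p.b i)) (hxb2 : ¬E x (p.b j)) (hxc2 : ¬E x (p.c j)) (hxc3 :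
    ¬E x (p.c k)) (hyb1 : E y (p.b i)) (hyb2 : ¬E y (p.b j)) (hyc2 : ¬E y (p.c j)) (hyc3 : ¬E y (p.c
    k)) : E x y := by
  grind only [h.symm, hp.facts hd, h.PP y (p.b i) x (p.b j) (p.c j) (p.c k)]

theorem B_not_near_B (x y : V) (hxc1 : E x (p.c i)) (hxc2 : ¬E x (p.c j)) (hyc2 : E y (p.c j)) (hyc1
    : ¬E y (p.c i)) : ¬E x y := by
  grind only [h.symm, hp.facts hd, h.C4 (p.c j) y x (p.c i)]

theorem B_not_near_C (x y : V) (hxb1 : E x (p.b i)) (hxb2 : ¬E x (p.b j)) (hxb3 : ¬E x (p.b k))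
    (hxc2 : ¬E x (p.c j)) (hya : ¬E y p.a) (hyb2 : E y (p.b j)) (hyc3 : E y (p.c k)) : ¬E x y := by
  grind only [h.symm, hp.facts hd, h.C6 (p.c k) y x (p.b i) p.a (p.b k), h.C4 y (p.b k) p.a (p.b j),
    h.C4 y x p.a (p.b j), h.C4 y (p.b i) p.a (p.b j), h.C6 (p.c k) (p.c j) (p.b j) p.a (p.b i) x]

theorem A_not_near_C (x y : V) (hxb2 : E x (p.b j)) (hxc2 : ¬E x (p.c j)) (hya : ¬E y p.a) (hyb1 : E
    y (p.b i)) (hyc2 : E y (p.c j)) : ¬E x y := by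
  grind only [h.symm, hp.facts hd, h.C4 (p.b j) (p.c j) y x, h.C4 (p.b i) y (p.b j) p.a]

theorem A_not_near_C_ne (x y : V) (hxb2 : E x (p.b j)) (hxb3 : E x (p.b k)) (hxc2 : ¬E x (p.c j))
    (hya : ¬E y p.a) (hyb2 : E y (p.b j)) (hyc3 : E y (p.c k)) : ¬E x y := by
  grind only [h.symm, hp.facts hd, h.C4 (p.c k) y x (p.b k), h.C4 (p.b j) p.a (p.b k) y, h.C4 (p.b
    j) (p.c j) (p.c k) x]

theorem F_ne (x y : V) (hxa : E x p.a) (hxc2 : E x (p.c j)) (hxc3 : E x (p.c k)) (hxc1 : ¬E x (p.c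
    i)) (hya : E y p.a) (hyc1 : E y (p.c i)) (hyc3 : E y (p.c k)) (hyc2 : ¬E y (p.c j)) : False :=
    by
  grind only [h.symm, hp.facts hd, h.C4 p.a y (p.c k) x, h.C4 (p.c j) (p.c i) y x]

theorem near_of_common_a_c (x y : V) (hxa : E x p.a) (hxc1 : E x (p.c i)) (hya : E y p.a) (hyc1 : E
    y (p.c i)) : E x y := by
  grind only [h.symm, hp.facts hd, h.C4 y (p.c i) x p.a]

theorem F_not_near_B (x y : V) (hxc1 : ¬E x (p.c i)) (hxc2 : E x (p.c j)) (hyc1 : E y (p.c i)) (hyc2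
    : ¬E y (p.c j)) : ¬E x y := by
  grind only [h.symm, hp.facts hd, h.C4 (p.c j) x y (p.c i)]

theorem F_not_near_C (x y : V) (hxa : E x p.a) (hxb1 : ¬E x (p.b i)) (hyb1 : E y (p.b i)) (hya : ¬E
    y p.a) : ¬E x y := by
  grind only [h.symm, hp.facts hd, h.C4 x y (p.b i) p.a]

/-- This lemma and the next three show that a neighbor `x` of `v` that misses `u` misses a and c_j
and sees b_i and c_i, just as `v` does. So the vertices of this kind that miss `u` have only outside
neighbors that see `u`; see `near_of_R`. -/
theorem R_of_near_R (v x u : V) (hva : ¬E v p.a) (hvb1 : E v (p.b i)) (hvc1 : E v (p.c i)) (hvc2 :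
    ¬E v (p.c j)) (hua : E u p.a) (hub1 : E u (p.b i)) (huc1 : E u (p.c i)) (huc2 : E u (p.c j))
    (hvx : E v x) (hxu : ¬E x u) : ¬E x p.a := by
  grind only [h.symm, hp.facts hd, h.C4 (p.b j) p.a u (p.c j), h.C4 v x p.a (p.b i), h.C6 (p.b j)
    (p.c j) (p.c i) v x p.a, h.C4 v (p.b j) (p.c j) (p.c i), h.C4 (p.b i) u (p.c j) x, h.C4 (p.b i)
    u (p.b j) x, h.C4 p.a u (p.c i) x]

theorem b_of_near_R (v x : V) (hva : ¬E v p.a) (hvb1 : E v (p.b i)) (hvc1 : E v (p.c i)) (hvc2 : ¬E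
    v (p.c j)) (hvx : E v x) : E x (p.b i) := by
  grind only [h.symm, hp.facts hd, h.PP (p.c k) (p.c j) (p.b j) (p.b i) v x, h.PP (p.c j) (p.c k)
    (p.b k) (p.b i) v x, h.C4 (p.b i) v (p.b k) p.a, h.C4 (p.b i) v x p.a, h.C4 (p.c i) v (p.b j)
    (p.c j), h.C4 x (p.b j) p.a (p.b k), h.C6 (p.b j) p.a (p.b i) v (p.c k) (p.c j), h.C6 (p.b k)
    p.a (p.b i) v x (p.c k), h.C7 p.a (p.b k) (p.c k) (p.c j) x v (p.b i), h.C6 p.a (p.b i) v x (p.c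
    j) (p.b j), h.C7 x v (p.b i) p.a (p.b j) (p.c j) (p.c k)]

theorem c_of_near_R (v x u : V) (hva : ¬E v p.a) (hvb1 : E v (p.b i)) (hvc1 : E v (p.c i)) (hvc2 :
    ¬E v (p.c j)) (hua : E u p.a) (hub1 : E u (p.b i)) (huc2 : E u (p.c j)) (hvx : E v x) (hxu : ¬E
    x u) : E x (p.c i) := by
  grind only [h.symm, hp.facts hd, h.C4 u (p.c j) (p.b j) p.a, h.PP (p.c i) v x (p.b j) p.a (p.b k),
    h.C4 v x (p.c j) (p.c i), h.C4 v (p.c i) (p.c j) (p.b j), h.C4 v (p.b k) p.a (p.b i), h.C4 (p.b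
    j) (p.c j) (p.c k) x, h.C4 (p.b j) u (p.b i) x, h.C6 v (p.c i) (p.c j) (p.b j) p.a x, h.C4 x p.a
    (p.b i) v, h.C6 (p.b j) p.a (p.b k) (p.c k) v x, h.C4 x (p.b j) p.a (p.b k), h.PP (p.b i) v x
    (p.b k) (p.c k) (p.c j), h.C7 (p.b k) x v (p.c i) (p.c j) (p.b j) p.a]

theorem not_c_of_near_R (v x u : V) (hva : ¬E v p.a) (hvb1 : E v (p.b i)) (hvc1 : E v (p.c i)) (hvc2
    : ¬E v (p.c j)) (hua : E u p.a) (hub1 : E u (p.b i)) (huc1 : E u (p.c i)) (huc2 : E u (p.c j))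
    (hvx : E v x) (hxu : ¬E x u) : ¬E x (p.c j) := by
  grind only [h.symm, hp.facts hd, h.C4 (p.c i) (p.c j) x v, h.C4 (p.c j) (p.b j) p.a u, h.C6 (p.b
    i) p.a (p.b j) (p.c j) x v, h.C4 u (p.b j) x (p.c i), h.C4 p.a u (p.c i) x, h.C4 p.a (p.b i) v
    (p.b j), h.C4 (p.b i) u (p.c j) x]

theorem near_or_b_or_b_of_near_R (v w x : V) (hva : ¬E v p.a) (hvb1 : E v (p.b i)) (hvc1 : E v (p.c
    i)) (hvc2 : ¬E v (p.c j)) (hwa : ¬E w p.a) (hwb1 : E w (p.b i)) (hwc1 : E w (p.c i)) (hwc2 : ¬E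
    w (p.c j)) (hvx : E v x) : E w x ∨ E x (p.b j) ∨ E x (p.b k) := by
  grind only [h.symm, hp.facts hd, h.PP (p.b j) p.a (p.b k) (p.c i) v x, h.C4 (p.c i) w (p.b j) (p.c
    j), h.C4 (p.c i) v (p.b j) (p.c j), h.C4 (p.c k) (p.b k) p.a x, h.C4 v (p.b i) p.a (p.b k), h.C4
    (p.b j) p.a x (p.c j), h.C4 w (p.b k) p.a (p.b i), h.C6 w (p.b i) p.a (p.b j) (p.c j) (p.c k),
    h.PP (p.c k) (p.c j) (p.b j) w (p.b i) x, h.C4 (p.b i) v x p.a, h.PP x (p.c i) w (p.b k) p.a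
    (p.b j)]

end

end FiveHoled.Frame

/-! ### Extending a pentagon by a far vertex -/

namespace FiveHoled.Frame

variable {V ι : Type*} {E : V → V → Prop} {p : Frame ι V}

/-- Two pairs chosen from three indices meet in one or two of them: `near_of_b_b` and
`near_of_common_b` treat these cases. -/
theorem near_of_two_b (h : Admissible E) (hp : p.IsPentagon E) {i j k : ι}
    (hd : i ≠ j ∧ i ≠ k ∧ j ≠ k) (x y : V)
    (hx : (E x (p.b i) ∧ (E x (p.b j) ∨ E x (p.b k))) ∨ (E x (p.b j) ∧ E x (p.b k)))
    (hy : (E y (p.b i) ∧ (E y (p.b j) ∨ E y (p.b k))) ∨ (E y (p.b j) ∧ E y (p.b k))) : E x y := by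
  obtain ⟨hij, hik, hjk⟩ := id hd
  have := near_of_common_b h hp hd x y
  have := near_of_common_b h hp ⟨hik, hij, hjk.symm⟩ x y
  have := near_of_common_b h hp ⟨hjk, hij.symm, hik.symm⟩ x y
  have := near_of_b_b h hp hd x y
  have := near_of_b_b h hp ⟨hik, hij, hjk.symm⟩ x y
  have := near_of_b_b h hp ⟨hjk, hij.symm, hik.symm⟩ x y
  have := near_of_b_b h hp ⟨hij.symm, hjk, hik⟩ x y
  have := near_of_b_b h hp ⟨hik.symm, hjk.symm, hij⟩ x y
  have := near_of_b_b h hp ⟨hjk.symm, hik.symm, hij.symm⟩ x y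
  grind +splitImp only

theorem c_of_c_of_no_b [Finite V] (h : Admissible E) (hp : p.IsPentagon E)
    (hs : ∀ v, ¬Simplicial E v) (hι : ∀ l m : ι, ∃ n, n ≠ l ∧ n ≠ m) {v : V}
    (hva : ¬E v p.a) (hvb : ∀ l, ¬E v (p.b l)) {l : ι} (hvc : E v (p.c l)) (m : ι) :
    E v (p.c m) := by
  by_cases hlm : l = m
  · exact hlm ▸ hvc
  obtain ⟨n, hnl, hnm⟩ := hι l m
  rcases c_of_c_of_not_b h hp hs ⟨hlm, hnl.symm, hnm.symm⟩ (hvb l) hvc with h' | h'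
  · exact h'
  · exact c_of_c_of_c h hp hs ⟨Ne.symm hlm, hnm.symm, hnl.symm⟩ hva hvc h'

/-- If some vertex is nonadjacent to all the `b l` and `c l`, then the pentagon can be extended. -/
theorem exists_far_near_Y [Finite V] (h : Admissible E) (hp : p.IsPentagon E)
    (hs : ∀ v, ¬Simplicial E v) (hι : ∀ l m : ι, ∃ n, n ≠ l ∧ n ≠ m) (i : ι) {v : V}
    (hv : ∀ l, ¬E v (p.b l) ∧ ¬E v (p.c l)) :
    ∃ w y, (∀ l, ¬E w (p.b l) ∧ ¬E w (p.c l)) ∧ E w p.a ∧ E w y ∧ ¬E y p.a ∧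
      (∀ l, ¬E y (p.b l)) ∧ ∀ l, E y (p.c l) := by
  by_contra! hno
  obtain ⟨j, hji, -⟩ := hι i i
  have trans : ∀ x y z, (∀ l, ¬E x (p.b l) ∧ ¬E x (p.c l)) → (∀ l, ¬E y (p.b l) ∧ ¬E y (p.c l)) →
      (∀ l, ¬E z (p.b l) ∧ ¬E z (p.c l)) → E x y → E y z → E x z := by
    intro x y z hx hy hz
    obtain ⟨k, hki, hkj⟩ := hι i j
    exact far_trans h hp ⟨hji.symm, hki.symm, hkj.symm⟩ x y z (hx i).1 (hx i).2 (hx j).2 (hy i).1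
      (hy i).2 (hy j).2 (hz i).1 (hz i).2 (hz j).2
  -- A neighbor outside the far vertices that misses every b sees all c's but not a; then `w` sees
  -- a, and the two are a pair excluded by `hno`.
  have key : ∀ w x, (∀ l, ¬E w (p.b l) ∧ ¬E w (p.c l)) → ¬(∀ l, ¬E x (p.b l) ∧ ¬E x (p.c l)) →
      E w x → ∃ l, E x (p.b l) := by
    intro w x hw hx hwx
    by_contra! hxb
    have hxa : ¬E x p.a := fun hxa => hx fun l => ⟨hxb l, fun hxc => by
      obtain ⟨m, hml, -⟩ := hι l l
      obtain ⟨n, hnl, hnm⟩ := hι l m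
      exact hxb l (b_of_a_c h hp ⟨hml.symm, hnl.symm, hnm.symm⟩ x hxa hxc)⟩
    obtain ⟨l, hl⟩ : ∃ l, E x (p.c l) := by
      by_contra! hxc
      exact hx fun l => ⟨hxb l, hxc l⟩
    have hxc := c_of_c_of_no_b h hp hs hι hxa hxb hl
    obtain ⟨m, hml, -⟩ := hι l l
    obtain ⟨n, hnl, hnm⟩ := hι l m
    have hwa := a_of_far_near_Y h hp ⟨hml.symm, hnl.symm, hnm.symm⟩ w x (hw m).1 (hw n).1 (hw l).2
      hxa (hxb m) (hxb n) hl hwx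
    obtain ⟨m, hm⟩ := hno w x hw hwa hwx hxa hxb
    exact hm (hxc m)
  have key' : ∀ w x i j k, (i ≠ j ∧ i ≠ k ∧ j ≠ k) → (∀ l, ¬E w (p.b l) ∧ ¬E w (p.c l)) →
      E w x → E x (p.b i) → E x (p.b j) ∨ E x (p.b k) := fun w x i j k hd hw hwx hx =>
    b_or_b_of_near_far h hp hd w x (hw i).1 (hw j).1 (hw k).1 (hw i).2 (hw j).2 (hw k).2 hwx hx
  -- By `trans`, this is the component of `v` among the far vertices, and it is a clique. Its
  -- outside neighbors see a b by `key`, hence two b's in any triple containing that index.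
  refine not_exists.2 hs (h.exists_simplicial
    (K := fun x => (∀ l, ¬E x (p.b l) ∧ ¬E x (p.c l)) ∧ E v x) ⟨v, hv, h.refl v⟩
    (fun x y hx hy => trans x v y hx.1 hv hy.1 ((h.symm _ _).1 hx.2) hy.2) ?_)
  rintro w w' x y ⟨hw, hvw⟩ ⟨hw', hvw'⟩ hx hy hwx hwy
  obtain ⟨l, hl⟩ := key w x hw (fun hx' => hx ⟨hx', trans v w x hv hw hx' hvw hwx⟩) hwx
  obtain ⟨m, hm⟩ := key w' y hw' (fun hy' => hy ⟨hy', trans v w' y hv hw' hy' hvw' hwy⟩) hwy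
  obtain ⟨n, hnl, hnm⟩ := hι l m
  by_cases hlm : l = m
  · subst hlm
    obtain ⟨m, hml, hmn⟩ := hι l n
    have hd : l ≠ m ∧ l ≠ n ∧ m ≠ n := ⟨hml.symm, hnl.symm, hmn⟩
    have := key' w x l m n hd hw hwx hl
    have := key' w' y l m n hd hw' hwy hm
    have := near_of_two_b h hp hd x y
    clear key key' trans
    grind only
  · have hd : l ≠ m ∧ l ≠ n ∧ m ≠ n := ⟨hlm, hnl.symm, hnm.symm⟩
    have := key' w x l m n hd hw hwx hl
    have := key' w' y m l n ⟨Ne.symm hlm, hnm.symm, hnl.symm⟩ hw' hwy hm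
    have := near_of_two_b h hp hd x y
    clear key key' trans
    grind only

end FiveHoled.Frame

/-! ### Nested orderings, and the neighbors of vertices of type R -/

namespace FiveHoled

/-- Inclusion of the traces on `T` is a total preorder on `S`, so `S` can be sorted by it. The head
of the sorted list has the largest trace, which is `T` by `htop`. -/
theorem exists_isNestedOrdering {V : Type*} [Finite V] {G : SimpleGraph V} {S T : Set V}
    (hchain : ∀ x ∈ S, ∀ y ∈ S,
      G.neighborSet y ∩ T ⊆ G.neighborSet x ∩ T ∨ G.neighborSet x ∩ T ⊆ G.neighborSet y ∩ T)
    (htop : ∃ x ∈ S, ∀ t ∈ T, G.Adj x t) :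
    ∃ (n : ℕ) (e : Fin (n + 1) → V), IsNestedOrdering G S T e := by
  classical
  obtain ⟨x, hx, hxT⟩ := htop
  have : Fintype S := Fintype.ofFinite S
  let r : S → S → Prop := fun y z => G.neighborSet z ∩ T ⊆ G.neighborSet y ∩ T
  have : Std.Total r := ⟨fun y z => hchain y y.2 z z.2⟩
  have : IsTrans S r := ⟨fun _ _ _ h₁ h₂ => h₂.trans h₁⟩
  let l : List S := (Finset.univ : Finset S).toList.insertionSort r
  have hl : l.Pairwise r := List.pairwise_insertionSort r _
  have hmem : ∀ y : S, y ∈ l := fun y => by simp [l]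
  have hnd : l.Nodup :=
    (List.perm_insertionSort r _).nodup_iff.2 (Finset.nodup_toList _)
  obtain ⟨n, hn⟩ : ∃ n, l.length = n + 1 :=
    Nat.exists_eq_add_one.2 (List.length_pos_of_mem (hmem ⟨x, hx⟩))
  let e : Fin (n + 1) → V := fun k => (l.get (k.cast hn.symm)).1
  have hsurj : ∀ y ∈ S, ∃ k, e k = y := fun y hy => by
    obtain ⟨k, hk⟩ := List.get_of_mem (hmem ⟨y, hy⟩)
    exact ⟨k.cast hn, congrArg Subtype.val hk⟩
  have hanti : ∀ k m, k ≤ m → G.neighborSet (e m) ∩ T ⊆ G.neighborSet (e k) ∩ T := by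
    intro k m hkm
    rcases hkm.eq_or_lt with rfl | hkm
    · exact subset_rfl
    · exact List.pairwise_iff_get.1 hl (k.cast hn.symm) (m.cast hn.symm) hkm
  refine ⟨n, e, ⟨fun k m hkm => ?_, ?_, hanti, ?_⟩⟩
  · have := hnd.injective_get (Subtype.ext hkm)
    simpa using this
  · ext y
    exact ⟨fun ⟨k, hk⟩ => hk ▸ (l.get _).2, fun hy => hsurj y hy⟩
  · obtain ⟨k, hk⟩ := hsurj x hx
    refine Set.inter_subset_right.antisymm fun t ht => hanti 0 k (Fin.zero_le k) ⟨?_, ht⟩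
    exact hk ▸ hxT t ht

namespace Frame

variable {V ι : Type*} {E : V → V → Prop} {p : Frame ι V}

/-- The exceptions form a clique whose outside neighbors all see `u`. For two such neighbors `x` of
`v` and `y` of `w`, either both see two b's, or an edge `w x` or `v y` closes a four-cycle through
`u`, which `v` and `w` miss. -/
theorem near_of_R [Finite V] (h : Admissible E) (hp : p.IsPentagon E)
    (hs : ∀ v, ¬Simplicial E v) {i j k : ι} (hd : i ≠ j ∧ i ≠ k ∧ j ≠ k) {u r : V}
    (hua : E u p.a) (hub : E u (p.b i)) (huc : E u (p.c i)) (huc' : E u (p.c j))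
    (hra : ¬E r p.a) (hrb : E r (p.b i)) (hrc : E r (p.c i)) (hrc' : ¬E r (p.c j)) : E r u := by
  by_contra hru
  refine not_exists.2 hs (h.exists_simplicial
    (K := fun x => (¬E x p.a ∧ E x (p.b i) ∧ E x (p.c i) ∧ ¬E x (p.c j)) ∧ ¬E x u)
    ⟨r, ⟨hra, hrb, hrc, hrc'⟩, hru⟩ ?_ ?_)
  · rintro x y ⟨hx, -⟩ ⟨hy, -⟩
    have := B_near_B h hp hd x y hx.2.1
    have := fun z => a_of_b_b h hp hd z
    have := fun z => c_of_not_a h hp ⟨hd.2.1, hd.1, hd.2.2.symm⟩ z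
    grind +splitImp only
  have key : ∀ v w x, ((¬E v p.a ∧ E v (p.b i) ∧ E v (p.c i) ∧ ¬E v (p.c j)) ∧ ¬E v u) →
      ((¬E w p.a ∧ E w (p.b i) ∧ E w (p.c i) ∧ ¬E w (p.c j)) ∧ ¬E w u) →
      ¬((¬E x p.a ∧ E x (p.b i) ∧ E x (p.c i) ∧ ¬E x (p.c j)) ∧ ¬E x u) → E v x →
      E x u ∧ (E w x ∨ E x (p.b i) ∧ (E x (p.b j) ∨ E x (p.b k))) := by
    rintro v w x ⟨⟨h₁, h₂, h₃, h₄⟩, h₅⟩ ⟨⟨h₁', h₂', h₃', h₄'⟩, h₅'⟩ hx hvx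
    have := R_of_near_R h hp hd v x u h₁ h₂ h₃ h₄ hua hub huc huc' hvx
    have := b_of_near_R h hp hd v x h₁ h₂ h₃ h₄ hvx
    have := c_of_near_R h hp hd v x u h₁ h₂ h₃ h₄ hua hub huc' hvx
    have := not_c_of_near_R h hp hd v x u h₁ h₂ h₃ h₄ hua hub huc huc' hvx
    have := near_or_b_or_b_of_near_R h hp hd v w x h₁ h₂ h₃ h₄ h₁' h₂' h₃' h₄' hvx
    grind only
  intro v w x y hv hw hx hy hvx hwy
  have hx' := key v w x hv hw hx hvx
  have hy' := key w v y hw hv hy hwy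
  have := near_of_two_b h hp hd x y
  have := h.C4 w x u y
  have := h.C4 v y u x
  have := h.symm x y
  have := h.symm y u
  have := h.symm x u
  have := h.symm y w
  have := h.symm x v
  have := h.symm u w
  have := h.symm u v
  clear key
  grind only

end Frame
end FiveHoled

/-! ### Classification of the vertices in the 5-basket case -/

namespace FiveHoled.Frame

variable {V ι : Type*} {E : V → V → Prop} {p : Frame ι V}

theorem exists_ne_ne {i j k : ι} (hd : i ≠ j ∧ i ≠ k ∧ j ≠ k) (l m : ι) : ∃ n, n ≠ l ∧ n ≠ m := by
  by_contra! hno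
  have := hno i
  have := hno j
  have := hno k
  by_cases i = l <;> by_cases j = l <;> grind only

/-- For vertices that see a, the local rules and the exclusions due to `w` suffice; for the others,
the absence of simplicial vertices is needed as well. What remains is an enumeration of adjacency
patterns. -/
theorem basket_cases_aux [Finite V] (h : Admissible E) (hp : p.IsPentagon E)
    (hs : ∀ v, ¬Simplicial E v) {i j k : ι} (hd : i ≠ j ∧ i ≠ k ∧ j ≠ k) {w : V}
    (hw : p.IsR E i w ∨ p.IsA' E i w) (x : V)
    (hx : E x (p.b i) ∨ E x (p.b j) ∨ E x (p.b k) ∨ E x (p.c i) ∨ E x (p.c j) ∨ E x (p.c k)) :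
    (E x p.a ∧ E x (p.b j) ∧ E x (p.b k) ∧ ¬E x (p.c i) ∧ ¬E x (p.c j) ∧ ¬E x (p.c k)) ∨
    (E x (p.b i) ∧ E x (p.c i) ∧ ¬E x (p.b j) ∧ ¬E x (p.c j) ∧ ¬E x (p.b k) ∧ ¬E x (p.c k)) ∨
    (E x p.a ∧ E x (p.b j) ∧ E x (p.c j) ∧ ¬E x (p.b i) ∧ ¬E x (p.c i) ∧ ¬E x (p.b k) ∧
      ¬E x (p.c k)) ∨
    (E x p.a ∧ E x (p.b k) ∧ E x (p.c k) ∧ ¬E x (p.b i) ∧ ¬E x (p.c i) ∧ ¬E x (p.b j) ∧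
      ¬E x (p.c j)) ∨
    (¬E x p.a ∧ E x (p.c i) ∧ E x (p.c j) ∧ E x (p.c k) ∧
      (E x (p.b i) ∧ ¬E x (p.b j) ∧ ¬E x (p.b k) ∨ ¬E x (p.b i) ∧ E x (p.b j) ∧ ¬E x (p.b k) ∨
      ¬E x (p.b i) ∧ ¬E x (p.b j) ∧ E x (p.b k))) ∨
    (E x p.a ∧ ¬E x (p.b i) ∧ E x (p.b j) ∧ E x (p.b k) ∧ ¬E x (p.c i) ∧ E x (p.c j) ∧
      E x (p.c k)) ∨
    (E x p.a ∧ E x (p.b i) ∧ ¬E x (p.b j) ∧ E x (p.b k) ∧ E x (p.c i) ∧ ¬E x (p.c j) ∧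
      E x (p.c k)) ∨
    (E x p.a ∧ E x (p.b i) ∧ E x (p.b j) ∧ ¬E x (p.b k) ∧ E x (p.c i) ∧ E x (p.c j) ∧
      ¬E x (p.c k)) ∨
    (E x p.a ∧ E x (p.b i) ∧ E x (p.b j) ∧ E x (p.b k) ∧ E x (p.c i) ∧ E x (p.c j) ∧
      E x (p.c k)) := by
  obtain ⟨hij, hik, hjk⟩ := id hd
  have d₁ : i ≠ k ∧ i ≠ j ∧ k ≠ j := ⟨hik, hij, hjk.symm⟩
  have d₂ : j ≠ i ∧ j ≠ k ∧ i ≠ k := ⟨hij.symm, hjk, hik⟩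
  have d₃ : j ≠ k ∧ j ≠ i ∧ k ≠ i := ⟨hjk, hij.symm, hik.symm⟩
  have d₄ : k ≠ i ∧ k ≠ j ∧ i ≠ j := ⟨hik.symm, hjk.symm, hij⟩
  have d₅ : k ≠ j ∧ k ≠ i ∧ j ≠ i := ⟨hjk.symm, hik.symm, hij.symm⟩
  have h₁ := c_of_b_c h hp hd x
  have h₂ := c_of_b_c h hp d₁ x
  have h₃ := c_of_b_c h hp d₂ x
  have h₄ := c_of_b_c h hp d₃ x
  have h₅ := c_of_b_c h hp d₄ x
  have h₆ := c_of_b_c h hp d₅ x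
  by_cases hxa : E x p.a
  · have := b_of_a_c h hp hd x hxa
    have := b_of_a_c h hp d₂ x hxa
    have := b_of_a_c h hp d₄ x hxa
    have := not_X h hp hd w x hw hxa
    have := not_X_ne h hp hd w x hw hxa
    have := not_X_ne h hp d₁ w x hw hxa
    have := not_A'_ne h hp hd w x hw
    have := not_A'_ne h hp d₁ w x hw
    clear h hp hs hw hd d₁ d₂ d₃ d₄ d₅ hij hik hjk
    by_cases E x (p.b i) <;> by_cases E x (p.b j) <;> by_cases E x (p.b k) <;>
      grind +splitImp only
  · have := fun hx => c_of_not_a_b h hp hs hd hxa hx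
    have := fun hx => c_of_not_a_b h hp hs d₂ hxa hx
    have := fun hx => c_of_not_a_b h hp hs d₄ hxa hx
    have := c_of_not_a h hp hd x hxa
    have := c_of_not_a h hp d₁ x hxa
    have := c_of_not_a h hp d₂ x hxa
    have := c_of_not_a h hp d₃ x hxa
    have := c_of_not_a h hp d₄ x hxa
    have := c_of_not_a h hp d₅ x hxa
    have := c_of_c_of_not_b h hp hs hd (v := x)
    have := c_of_c_of_not_b h hp hs d₂ (v := x)
    have := c_of_c_of_not_b h hp hs d₄ (v := x)
    have := c_of_c_of_c h hp hs hd hxa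
    have := c_of_c_of_c h hp hs d₂ hxa
    have := c_of_c_of_c h hp hs d₄ hxa
    have := a_of_b_b h hp hd x
    have := a_of_b_b h hp d₁ x
    have := a_of_b_b h hp d₃ x
    have := not_Y h hp hd w x hw hxa
    have := not_R_ne h hp hd w x hw hxa
    have := not_R_ne h hp d₁ w x hw hxa
    clear h hp hs hw hd d₁ d₂ d₃ d₄ d₅ hij hik hjk
    by_cases E x (p.b i) <;> by_cases E x (p.b j) <;> by_cases E x (p.b k) <;>
      grind +splitImp only

variable (p) (E) in
/-- The vertices of a 5-basket that belong to `A` or to its counterpart missing `b i`. -/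
def LikeA (i : ι) (x : V) : Prop :=
  E x p.a ∧ (∀ l, l ≠ i → E x (p.b l)) ∧ ∀ l, ¬E x (p.c l)

variable (p) (E) in
/-- The vertices that are related to the `b l` and `c l` as `b i` is. -/
def LikeB (i : ι) (x : V) : Prop :=
  E x (p.b i) ∧ E x (p.c i) ∧ ∀ l, l ≠ i → ¬E x (p.b l) ∧ ¬E x (p.c l)

theorem basket_cases [Finite V] (h : Admissible E) (hp : p.IsPentagon E)
    (hs : ∀ v, ¬Simplicial E v) {i j k : ι} (hd : i ≠ j ∧ i ≠ k ∧ j ≠ k)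
    (hc : ∀ l, l = i ∨ l = j ∨ l = k) {w : V} (hw : p.IsR E i w ∨ p.IsA' E i w) (x : V) :
    p.LikeA E i x ∨ (∃ l, p.LikeB E l x ∧ (l ≠ i → E x p.a)) ∨ (∃ l, p.IsC E l x) ∨
      (∃ l, p.IsF E l x) ∨ p.IsU E x := by
  have all : ∀ {P : ι → Prop}, P i → P j → P k → ∀ l, P l := fun h₁ h₂ h₃ l => by
    rcases hc l with rfl | rfl | rfl <;> assumption
  have hι : ∀ l m : ι, ∃ n, n ≠ l ∧ n ≠ m := exists_ne_ne hd
  have hx : E x (p.b i) ∨ E x (p.b j) ∨ E x (p.b k) ∨ E x (p.c i) ∨ E x (p.c j) ∨ E x (p.c k) := by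
    by_contra! hx
    -- A far vertex would produce a vertex of type Y, which cannot coexist with `w`.
    obtain ⟨u, y, -, -, -, hya, hyb, hyc⟩ := exists_far_near_Y h hp hs hι i (v := x)
      (all ⟨hx.1, hx.2.2.2.1⟩ ⟨hx.2.1, hx.2.2.2.2.1⟩ ⟨hx.2.2.1, hx.2.2.2.2.2⟩)
    exact not_Y h hp hd w y hw hya (hyb i) (hyb j) (hyb k) (hyc i) (hyc j) (hyc k)
  have key := basket_cases_aux h hp hs hd hw x hx
  obtain ⟨hij, hik, hjk⟩ := hd
  clear hw hs hp h hι hx hc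
  simp only [LikeA, LikeB, IsC, IsF, IsU, HasType]
  rcases key with hx | hx | hx | hx | ⟨hxa, hi, hj, hk, hx | hx | hx⟩ | hx | hx | hx | hx
  · exact Or.inl ⟨hx.1, all (by simp) (by simp [hx]) (by simp [hx]),
      all (by simp [hx]) (by simp [hx]) (by simp [hx])⟩
  · exact Or.inr (Or.inl ⟨i, ⟨hx.1, hx.2.1, all (by simp) (by simp [hx]) (by simp [hx])⟩, by simp⟩)
  · exact Or.inr (Or.inl ⟨j, ⟨hx.2.1, hx.2.2.1,
      all (by simp [hx]) (by simp) (by simp [hx])⟩, fun _ => hx.1⟩)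
  · exact Or.inr (Or.inl ⟨k, ⟨hx.2.1, hx.2.2.1,
      all (by simp [hx]) (by simp [hx]) (by simp)⟩, fun _ => hx.1⟩)
  · exact Or.inr (Or.inr (Or.inl ⟨i, by simpa using hxa, all (by simp [*]) (by grind) (by grind)⟩))
  · exact Or.inr (Or.inr (Or.inl ⟨j, by simpa using hxa, all (by grind) (by grind) (by grind)⟩))
  · exact Or.inr (Or.inr (Or.inl ⟨k, by simpa using hxa, all (by grind) (by grind) (by grind)⟩))
  · exact Or.inr (Or.inr (Or.inr (Or.inl
      ⟨i, by simp [hx], all (by grind) (by grind) (by grind)⟩)))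
  · exact Or.inr (Or.inr (Or.inr (Or.inl
      ⟨j, by simp [hx], all (by grind) (by grind) (by grind)⟩)))
  · exact Or.inr (Or.inr (Or.inr (Or.inl
      ⟨k, by simp [hx], all (by grind) (by grind) (by grind)⟩)))
  · exact Or.inr (Or.inr (Or.inr (Or.inr
      ⟨by simp [hx], all (by simp [hx]) (by simp [hx]) (by simp [hx])⟩)))

end FiveHoled.Frame

/-! ### Comparable neighborhoods, and adjacency between the parts of a 5-basket -/

namespace FiveHoled

theorem isClique_of_near {V : Type*} {G : SimpleGraph V} {S : Set V}
    (h : ∀ x ∈ S, ∀ y ∈ S, Near G x y) : G.IsClique S :=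
  fun x hx y hy hxy => (h x hx y hy).resolve_left hxy

theorem isCompleteBetween_of_near {V : Type*} {G : SimpleGraph V} {S T : Set V}
    (hST : Disjoint S T) (h : ∀ x ∈ S, ∀ y ∈ T, Near G x y) : G.IsCompleteBetween S T :=
  fun x hx y hy => (h x hx y hy).resolve_left fun hxy =>
    Set.disjoint_left.1 hST hx (hxy ▸ hy)

theorem isAnticompleteBetween_of_not_near {V : Type*} {G : SimpleGraph V} {S T : Set V}
    (h : ∀ x ∈ S, ∀ y ∈ T, ¬Near G x y) : IsAnticompleteBetween G S T :=
  fun x hx y hy hxy => h x hx y hy (Or.inr hxy)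

/-- In a `C₄`-free graph, the neighborhoods of the vertices of a clique in another clique are
nested. -/
theorem exists_isNestedOrdering_of_near {V : Type*} [Finite V] {G : SimpleGraph V}
    (h : Admissible (Near G)) {S T : Set V} (hST : Disjoint S T)
    (hS : ∀ x ∈ S, ∀ y ∈ S, Near G x y) (hT : ∀ x ∈ T, ∀ y ∈ T, Near G x y)
    (htop : ∃ x ∈ S, ∀ t ∈ T, Near G x t) :
    ∃ (n : ℕ) (e : Fin (n + 1) → V), IsNestedOrdering G S T e := by
  have hadj : ∀ x ∈ S, ∀ t ∈ T, (G.Adj x t ↔ Near G x t) := fun x hx t ht =>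
    ⟨Or.inr, fun hxt => hxt.resolve_left fun hxt => Set.disjoint_left.1 hST hx (hxt ▸ ht)⟩
  refine exists_isNestedOrdering (fun x hx y hy => ?_) ?_
  · by_contra! hno
    obtain ⟨⟨t, ⟨hyt, ht⟩, hxt⟩, ⟨s, ⟨hxs, hs⟩, hys⟩⟩ := hno.imp Set.not_subset.1 Set.not_subset.1
    replace hxt : ¬Near G x t := fun hn => hxt ⟨(hadj x hx t ht).2 hn, ht⟩
    replace hys : ¬Near G y s := fun hn => hys ⟨(hadj y hy s hs).2 hn, hs⟩
    replace hyt : Near G y t := (hadj y hy t ht).1 hyt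
    replace hxs : Near G x s := (hadj x hx s hs).1 hxs
    have := h.C4 x y t s
    have := hS x hx y hy
    have := hT t ht s hs
    grind only [h.symm]
  · obtain ⟨x, hx, hxT⟩ := htop
    exact ⟨x, hx, fun t ht => (hadj x hx t ht).2 (hxT t ht)⟩

namespace Frame

variable {V ι : Type*} {E : V → V → Prop} {p : Frame ι V} {x y : V}

theorem IsC.not_a {l : ι} (hx : p.IsC E l x) : ¬E x p.a := hx.1.1
theorem IsC.b {l : ι} (hx : p.IsC E l x) : E x (p.b l) := (hx.2 l).1.2 rfl
theorem IsC.not_b {l m : ι} (hx : p.IsC E l x) (h : m ≠ l) : ¬E x (p.b m) := fun h' =>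
  h ((hx.2 m).1.1 h')
theorem IsC.c {l : ι} (hx : p.IsC E l x) (m : ι) : E x (p.c m) := (hx.2 m).2.2 trivial
theorem IsF.a {l : ι} (hx : p.IsF E l x) : E x p.a := hx.1.2 trivial
theorem IsF.b {l m : ι} (hx : p.IsF E l x) (h : m ≠ l) : E x (p.b m) := (hx.2 m).1.2 h
theorem IsF.c {l m : ι} (hx : p.IsF E l x) (h : m ≠ l) : E x (p.c m) := (hx.2 m).2.2 h
theorem IsF.not_b {l : ι} (hx : p.IsF E l x) : ¬E x (p.b l) := fun h => (hx.2 l).1.1 h rfl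
theorem IsF.not_c {l : ι} (hx : p.IsF E l x) : ¬E x (p.c l) := fun h => (hx.2 l).2.1 h rfl
theorem IsU.a (hx : p.IsU E x) : E x p.a := hx.1.2 trivial
theorem IsU.b (hx : p.IsU E x) (m : ι) : E x (p.b m) := (hx.2 m).1.2 trivial
theorem IsU.c (hx : p.IsU E x) (m : ι) : E x (p.c m) := (hx.2 m).2.2 trivial

theorem exists_distinct {i j k : ι} (hd : i ≠ j ∧ i ≠ k ∧ j ≠ k) (l : ι) :
    ∃ m n, l ≠ m ∧ l ≠ n ∧ m ≠ n := by
  obtain ⟨m, hm, -⟩ := exists_ne_ne hd l l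
  obtain ⟨n, hn, hn'⟩ := exists_ne_ne hd l m
  exact ⟨m, n, hm.symm, hn.symm, hn'.symm⟩

theorem exists_distinct_of_ne {i j k : ι} (hd : i ≠ j ∧ i ≠ k ∧ j ≠ k) {l m : ι} (hlm : l ≠ m) :
    ∃ n, l ≠ m ∧ l ≠ n ∧ m ≠ n := by
  obtain ⟨n, hn, hn'⟩ := exists_ne_ne hd l m
  exact ⟨n, hlm, hn.symm, hn'.symm⟩

section Basket

variable (h : Admissible E) (hp : p.IsPentagon E) {i j k : ι} (hd : i ≠ j ∧ i ≠ k ∧ j ≠ k)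
include h hp hd

theorem LikeA.near (hx : p.LikeA E i x) (hy : p.LikeA E i y) : E x y :=
  near_of_two_b h hp hd x y (Or.inr ⟨hx.2.1 j hd.1.symm, hx.2.1 k hd.2.1.symm⟩)
    (Or.inr ⟨hy.2.1 j hd.1.symm, hy.2.1 k hd.2.1.symm⟩)

theorem LikeB.near {l : ι} (hx : p.LikeB E l x) (hy : p.LikeB E l y) : E x y := by
  obtain ⟨m, n, hlm, hln, hmn⟩ := exists_distinct hd l
  exact B_near_B h hp ⟨hlm, hln, hmn⟩ x y hx.1 (hx.2.2 m hlm.symm).1 (hx.2.2 m hlm.symm).2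
    (hx.2.2 n hln.symm).2 hy.1 (hy.2.2 m hlm.symm).1 (hy.2.2 m hlm.symm).2 (hy.2.2 n hln.symm).2

theorem LikeB.not_near {l m : ι} (hlm : l ≠ m) (hx : p.LikeB E l x) (hy : p.LikeB E m y) :
    ¬E x y := by
  obtain ⟨n, hd'⟩ := exists_distinct_of_ne hd hlm
  exact B_not_near_B h hp hd' x y hx.2.1 (hx.2.2 m hlm.symm).2 hy.2.1 (hy.2.2 l hlm).2

theorem IsC.near {l m : ι} (hx : p.IsC E l x) (hy : p.IsC E m y) : E x y := by
  by_cases hlm : l = m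
  · subst hlm
    obtain ⟨m, n, hd'⟩ := exists_distinct hd l
    exact near_of_common_b_c h hp hd' x y hx.b (hx.c m) hy.b (hy.c m)
  · obtain ⟨n, hd'⟩ := exists_distinct_of_ne hd hlm
    exact C_near_C_ne h hp hd' x y hx.b hy.b (hx.not_b (Ne.symm hlm)) (hy.not_b hlm) hx.not_a
      hy.not_a (hx.c n) (hy.c n)

theorem IsF.near {l : ι} (hx : p.IsF E l x) (hy : p.IsF E l y) : E x y := by
  obtain ⟨m, n, hlm, hln, hmn⟩ := exists_distinct hd l
  exact near_of_two_b h hp ⟨hlm, hln, hmn⟩ x y (Or.inr ⟨hx.b hlm.symm, hx.b hln.symm⟩)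
    (Or.inr ⟨hy.b hlm.symm, hy.b hln.symm⟩)

theorem IsF.eq {l m : ι} (hx : p.IsF E l x) (hy : p.IsF E m y) : l = m := by
  by_contra hlm
  obtain ⟨n, -, hln, hmn⟩ := exists_distinct_of_ne hd hlm
  exact F_ne h hp ⟨hlm, hln, hmn⟩ x y hx.a (hx.c (Ne.symm hlm)) (hx.c hln.symm) hx.not_c hy.a
    (hy.c hlm) (hy.c hmn.symm) hy.not_c

theorem IsF.near_C {l m : ι} (hlm : l ≠ m) (hx : p.IsF E l x) (hy : p.IsC E m y) : E x y := by
  obtain ⟨n, -, hln, hmn⟩ := exists_distinct_of_ne hd hlm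
  exact near_of_common_b_c h hp ⟨hmn, hlm.symm, hln.symm⟩ x y (hx.b hlm.symm) (hx.c hln.symm) hy.b
    (hy.c n)

theorem IsF.not_near_B {l : ι} (hx : p.IsF E l x) (hy : p.LikeB E l y) : ¬E x y := by
  obtain ⟨m, n, hlm, hln, hmn⟩ := exists_distinct hd l
  exact F_not_near_B h hp ⟨hlm, hln, hmn⟩ x y hx.not_c (hx.c hlm.symm) hy.2.1
    (hy.2.2 m hlm.symm).2

theorem IsF.not_near_C {l : ι} (hx : p.IsF E l x) (hy : p.IsC E l y) : ¬E x y := by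
  obtain ⟨m, n, hd'⟩ := exists_distinct hd l
  exact F_not_near_C h hp hd' x y hx.a hx.not_b hy.b hy.not_a

theorem LikeB.not_near_C {l m : ι} (hlm : l ≠ m) (hx : p.LikeB E l x) (hy : p.IsC E m y) :
    ¬E x y := by
  obtain ⟨n, -, hln, hmn⟩ := exists_distinct_of_ne hd hlm
  exact B_not_near_C h hp ⟨hlm, hln, hmn⟩ x y hx.1 (hx.2.2 m hlm.symm).1 (hx.2.2 n hln.symm).1
    (hx.2.2 m hlm.symm).2 hy.not_a hy.b (hy.c n)

end Basket
end Frame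
end FiveHoled

/-! ### Assembling the 5-basket -/

namespace FiveHoled.Frame

variable {V : Type*} {G : SimpleGraph V} {p : Frame (Fin 3) V}

theorem isFiveBasket_of_R_or_A' [Finite V] (h : Admissible (Near G)) (hp : p.IsPentagon (Near G))
    (hs : ∀ v, ¬Simplicial (Near G) v) (hu : ∀ v, ∃ w, ¬Near G v w) {i j k : Fin 3}
    (hd : i ≠ j ∧ i ≠ k ∧ j ≠ k) {w : V} (hw : p.IsR (Near G) i w ∨ p.IsA' (Near G) i w) :
    IsFiveBasket G := by
  have hc : ∀ l, l = i ∨ l = j ∨ l = k := by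
    clear hw
    revert i j k
    decide
  have cases := basket_cases h hp hs hd hc hw
  have hAB : ∀ l, l ≠ i → ∀ x y, p.LikeA (Near G) i x → p.LikeB (Near G) l y → Near G y p.a →
      Near G x y := by
    intro l hl x y hx hy hya
    obtain ⟨n, hil, hin, hln⟩ := exists_distinct_of_ne hd hl.symm
    exact A_near_B_ne h hp ⟨hil, hin, hln⟩ w x y hw hx.1 (hx.2.1 l hl) (hx.2.1 n hin.symm)
      (hx.2.2 l) hya hy.1 hy.2.1 (hy.2.2 i hl.symm).1 (hy.2.2 n hln.symm).1
  have hBa : ∀ l, l ≠ i → ∀ y, p.LikeB (Near G) l y → Near G y p.a := by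
    intro l hl y hy
    by_contra hya
    obtain ⟨n, hil, hin, hln⟩ := exists_distinct_of_ne hd hl.symm
    exact (hy.2.2 n hln.symm).2 (not_R_ne h hp ⟨hil, hin, hln⟩ w y hw hya hy.1 hy.2.1)
  have hAC : ∀ l x y, p.LikeA (Near G) i x → p.IsC (Near G) l y → ¬Near G x y := by
    intro l x y hx hy
    by_cases hl : l = i
    · subst hl
      exact A_not_near_C h hp hd x y (hx.2.1 j hd.1.symm) (hx.2.2 j) hy.not_a hy.b (hy.c j)
    · obtain ⟨n, hil, hin, hln⟩ := exists_distinct_of_ne hd (Ne.symm hl)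
      exact A_not_near_C_ne h hp ⟨hil, hin, hln⟩ x y (hx.2.1 l hl) (hx.2.1 n hin.symm) (hx.2.2 l)
        hy.not_a hy.b (hy.c n)
  have hBC : ∀ l x y, p.LikeB (Near G) l x → p.IsC (Near G) l y → Near G x y := by
    intro l x y hx hy
    by_cases hl : l = i
    · subst hl
      exact B_near_C h hp hd w x y hw hx.1 hx.2.1 (hx.2.2 j hd.1.symm).1 (hx.2.2 k hd.2.1.symm).1
        (hx.2.2 j hd.1.symm).2 (hx.2.2 k hd.2.1.symm).2 hy.not_a hy.b (hy.c l) (hy.c j) (hy.c k)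
    · obtain ⟨n, hil, hin, hln⟩ := exists_distinct_of_ne hd (Ne.symm hl)
      exact B_near_C_ne h hp ⟨hil, hin, hln⟩ w x y hw (hBa l hl x hx) hx.1
        (hx.2.2 i (Ne.symm hl)).1 (hx.2.2 n hln.symm).1 hy.not_a hy.b (hy.c i) (hy.c n)
  -- Serves the types F and U alike: `C₄` settles the case that `y` sees a, and `near_of_R` the
  -- other.
  have hBig : ∀ x y, Near G x p.a → ∀ l, Near G x (p.b l) → Near G x (p.c l) →
      (∃ m, m ≠ l ∧ Near G x (p.c m)) → p.LikeB (Near G) l y → Near G x y := by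
    rintro x y hxa l hxb hxc ⟨m, hml, hxm⟩ hy
    obtain ⟨n, hd'⟩ := exists_distinct_of_ne hd hml.symm
    by_cases hya : Near G y p.a
    · exact near_of_common_a_c h hp hd' x y hxa hxc hya hy.2.1
    · exact (h.symm _ _).1 (near_of_R h hp hs hd' hxa hxb hxc hxm hya hy.1 hy.2.1
        (hy.2.2 m hml).2)
  have hFB : ∀ l m x y, l ≠ m → p.IsF (Near G) m x → p.LikeB (Near G) l y → Near G x y := by
    intro l m x y hlm hx hy
    obtain ⟨n, -, hln, hmn⟩ := exists_distinct_of_ne hd hlm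
    exact hBig x y hx.a l (hx.b hlm) (hx.c hlm) ⟨n, hln.symm, hx.c hmn.symm⟩ hy
  have hFA : ∀ m x y, p.IsF (Near G) m x → p.LikeA (Near G) i y → Near G x y := by
    intro m x y hx hy
    refine near_of_two_b h hp hd x y ?_ (Or.inr ⟨hy.2.1 j hd.1.symm, hy.2.1 k hd.2.1.symm⟩)
    have hb := fun l => @IsF.b _ _ _ _ _ m l hx
    rcases hc m with rfl | rfl | rfl
    · exact Or.inr ⟨hb j hd.1.symm, hb k hd.2.1.symm⟩
    · exact Or.inl ⟨hb i hd.1, Or.inr (hb k hd.2.2.symm)⟩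
    · exact Or.inl ⟨hb i hd.2.1, Or.inl (hb j hd.2.2)⟩
  have hU : ∀ x, ¬p.IsU (Near G) x := by
    intro x hx
    obtain ⟨y, hxy⟩ := hu x
    refine hxy ?_
    rcases cases y with hy | ⟨l, hy, -⟩ | ⟨l, hy⟩ | ⟨l, hy⟩ | hy
    · exact near_of_two_b h hp hd x y (Or.inr ⟨hx.b j, hx.b k⟩)
        (Or.inr ⟨hy.2.1 j hd.1.symm, hy.2.1 k hd.2.1.symm⟩)
    · obtain ⟨m, hml, -⟩ := exists_ne_ne hd l l
      exact hBig x y hx.a l (hx.b l) (hx.c l) ⟨m, hml, hx.c m⟩ hy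
    · obtain ⟨m, n, hd'⟩ := exists_distinct hd l
      exact near_of_common_b_c h hp hd' x y (hx.b l) (hx.c m) hy.b (hy.c m)
    · obtain ⟨m, n, hlm, hln, hmn⟩ := exists_distinct hd l
      exact near_of_two_b h hp ⟨hlm, hln, hmn⟩ x y (Or.inr ⟨hx.b m, hx.b n⟩)
        (Or.inr ⟨hy.b hlm.symm, hy.b hln.symm⟩)
    · exact near_of_two_b h hp hd x y (Or.inr ⟨hx.b j, hx.b k⟩) (Or.inr ⟨hy.b j, hy.b k⟩)
  have ha : p.LikeA (Near G) i p.a := ⟨h.refl _, fun l _ => hp.ab l, hp.ac⟩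
  have hb : ∀ l, p.LikeB (Near G) l (p.b l) := fun l =>
    ⟨h.refl _, hp.bc l, fun m hm => ⟨hp.bb l m hm.symm, hp.bc_ne l m hm.symm⟩⟩
  have hC : ∀ l, p.IsC (Near G) l (p.c l) := fun l =>
    ⟨iff_of_false (fun h' => hp.ac l ((h.symm _ _).1 h')) not_false, fun m =>
      ⟨⟨fun h' => by_contra fun hm => hp.bc_ne m l hm ((h.symm _ _).1 h'),
        fun hm => (h.symm _ _).1 (hm ▸ hp.bc l)⟩, iff_of_true (hp.cc l m) trivial⟩⟩
  -- If the `LikeA` vertex with the most neighbors in part B_i misses `r`, then by `C₄` no `LikeA`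
  -- vertex sees `r`. The vertices of B_i like this `r` form a clique with outside neighbors in B_i,
  -- C_i and F only; these are pairwise adjacent, so a simplicial vertex would exist.
  have htop : ∃ x, p.LikeA (Near G) i x ∧ ∀ y, p.LikeB (Near G) i y → Near G x y := by
    obtain ⟨x, hx, hmax⟩ := Set.exists_max_image {x | p.LikeA (Near G) i x}
      (fun x => {y | p.LikeB (Near G) i y ∧ Near G x y}.ncard) (Set.toFinite _) ⟨_, ha⟩
    by_contra! hno
    obtain ⟨r, hr, hxr⟩ := hno x hx
    have hr' : ∀ z, p.LikeA (Near G) i z → ¬Near G z r := by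
      intro z hz hzr
      refine absurd (hmax z hz) (not_le.2 (Set.ncard_lt_ncard ⟨?_, ?_⟩ (Set.toFinite _)))
      · rintro y ⟨hy, hxy⟩
        refine ⟨hy, ?_⟩
        have := h.C4 x z r y
        have := hx.near h hp hd hz
        have := hr.near h hp hd hy
        grind only [h.symm]
      · exact fun hle => hxr (hle ⟨hr, hzr⟩).2
    have nbr : ∀ v y, (p.LikeB (Near G) i v ∧ ∀ z, p.LikeA (Near G) i z → ¬Near G z v) →
        Near G v y → p.LikeB (Near G) i y ∨ p.IsC (Near G) i y ∨
          ∃ m, i ≠ m ∧ p.IsF (Near G) m y := by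
      rintro v y ⟨hv, hv'⟩ hvy
      rcases cases y with hy | ⟨l, hy, -⟩ | ⟨l, hy⟩ | ⟨l, hy⟩ | hy
      · exact absurd ((h.symm _ _).1 hvy) (hv' y hy)
      · by_cases hl : i = l
        · exact Or.inl (hl ▸ hy)
        · exact absurd hvy (hv.not_near h hp hd hl hy)
      · by_cases hl : i = l
        · exact Or.inr (Or.inl (hl ▸ hy))
        · exact absurd hvy (hv.not_near_C h hp hd hl hy)
      · by_cases hl : i = l
        · subst hl
          exact absurd ((h.symm _ _).1 hvy) (hy.not_near_B h hp hd hv)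
        · exact Or.inr (Or.inr ⟨l, hl, hy⟩)
      · exact absurd hy (hU y)
    refine not_exists.2 hs (h.exists_simplicial
      (K := fun v => p.LikeB (Near G) i v ∧ ∀ z, p.LikeA (Near G) i z → ¬Near G z v)
      ⟨r, hr, hr'⟩ (fun v w hv hw => hv.1.near h hp hd hw.1) ?_)
    intro v w y z hv hw _ _ hvy hwz
    rcases nbr v y hv hvy with hy | hy | ⟨l, hl, hy⟩ <;>
      rcases nbr w z hw hwz with hz | hz | ⟨m, hm, hz⟩
    · exact hy.near h hp hd hz
    · exact hBC i y z hy hz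
    · exact (h.symm _ _).1 (hFB i m z y hm hz hy)
    · exact (h.symm _ _).1 (hBC i z y hz hy)
    · exact hy.near h hp hd hz
    · exact (h.symm _ _).1 (hz.near_C h hp hd hm.symm hy)
    · exact hFB i l y z hl hy hz
    · exact hy.near_C h hp hd hl.symm hz
    · obtain rfl := hy.eq h hp hd hz
      exact hy.near h hp hd hz
  have disjAB : ∀ l, Disjoint {x | p.LikeA (Near G) i x} {x | p.LikeB (Near G) l x} := fun l =>
    Set.disjoint_left.2 fun x hx hy => hx.2.2 l hy.2.1
  have disjBC : ∀ l m, Disjoint {x | p.LikeB (Near G) l x} {x | p.IsC (Near G) m x} := fun l m =>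
    Set.disjoint_left.2 fun x hx hy => by
      obtain ⟨n, hn, -⟩ := exists_ne_ne hd l l
      exact (hx.2.2 n hn).2 (hy.c n)
  have disjCC : ∀ l m, l ≠ m → Disjoint {x | p.IsC (Near G) l x} {x | p.IsC (Near G) m x} :=
    fun l m hlm => Set.disjoint_left.2 fun x hx hy => hy.not_b hlm hx.b
  -- This is j*, the common index of the F vertices; if there are none, any index serves, and `i` is
  -- taken.
  obtain ⟨f, hf⟩ : ∃ f, ∀ x m, p.IsF (Near G) m x → m = f := by
    by_cases hne : ∃ x m, p.IsF (Near G) m x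
    · obtain ⟨x, m, hx⟩ := hne
      exact ⟨m, fun y l hy => hy.eq h hp hd hx⟩
    · exact ⟨i, fun x m hx => absurd ⟨x, m, hx⟩ hne⟩
  refine ⟨{x | p.LikeA (Near G) i x}, fun l => {x | p.LikeB (Near G) l x},
    fun l => {x | p.IsC (Near G) l x}, {x | ∃ m, p.IsF (Near G) m x}, ?_⟩
  exact
  { disjoint_A_B := disjAB
    disjoint_A_C := fun l => Set.disjoint_left.2 fun x hx hy => hx.2.2 l (hy.c l)
    disjoint_A_F := Set.disjoint_left.2 fun x hx ⟨m, hy⟩ => by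
      obtain ⟨n, hn, -⟩ := exists_ne_ne hd m m
      exact hx.2.2 n (hy.c hn)
    disjoint_B_B := fun l m hlm => Set.disjoint_left.2 fun x hx hy => (hy.2.2 l hlm).1 hx.1
    disjoint_B_C := disjBC
    disjoint_B_F := fun l => Set.disjoint_left.2 fun x hx ⟨m, hy⟩ => by
      obtain ⟨n, hnl, hnm⟩ := exists_ne_ne hd l m
      exact (hx.2.2 n hnl).1 (hy.b hnm)
    disjoint_C_C := disjCC
    disjoint_C_F := fun l => Set.disjoint_left.2 fun x hx ⟨m, hy⟩ => hx.not_a hy.a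
    cover := Set.eq_univ_of_forall fun x => by
      rcases cases x with hx | ⟨l, hx, -⟩ | ⟨l, hx⟩ | ⟨l, hx⟩ | hx
      · exact Or.inl (Or.inl (Or.inl hx))
      · exact Or.inl (Or.inl (Or.inr (Set.mem_iUnion.2 ⟨l, hx⟩)))
      · exact Or.inl (Or.inr (Set.mem_iUnion.2 ⟨l, hx⟩))
      · exact Or.inr ⟨l, hx⟩
      · exact absurd hx (hU x)
    nonempty_A := ⟨_, ha⟩
    nonempty_B := fun l => ⟨_, hb l⟩
    nonempty_C := fun l => ⟨_, hC l⟩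
    clique_A := isClique_of_near fun x hx y hy => hx.near h hp hd hy
    clique_B := fun l => isClique_of_near fun x hx y hy => hx.near h hp hd hy
    clique_C := fun l => isClique_of_near fun x hx y hy => hx.near h hp hd hy
    clique_F := isClique_of_near fun x ⟨l, hx⟩ y ⟨m, hy⟩ => by
      obtain rfl := hx.eq h hp hd hy
      exact hx.near h hp hd hy
    B_anticomplete_B := fun l m hlm => isAnticompleteBetween_of_not_near fun x hx y hy =>
      hx.not_near h hp hd hlm hy
    C_complete_C := fun l m hlm => isCompleteBetween_of_near (disjCC l m hlm)
      fun x hx y hy => hx.near h hp hd hy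
    A_B := ⟨i, fun l hl => isCompleteBetween_of_near (disjAB l)
        fun x hx y hy => hAB l hl x y hx hy (hBa l hl y hy),
      exists_isNestedOrdering_of_near h (disjAB i) (fun x hx y hy => hx.near h hp hd hy)
        (fun x hx y hy => hx.near h hp hd hy) htop⟩
    A_anticomplete_C := fun l => isAnticompleteBetween_of_not_near fun x hx y hy =>
      hAC l x y hx hy
    B_complete_C := fun l => isCompleteBetween_of_near (disjBC l l)
      fun x hx y hy => hBC l x y hx hy
    B_anticomplete_C := fun l m hlm => isAnticompleteBetween_of_not_near fun x hx y hy =>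
      hx.not_near_C h hp hd hlm hy
    F_rest := ⟨f, by
      refine isCompleteBetween_of_near (Set.disjoint_left.2 fun x hx hx' => hx' (Or.inr hx)) ?_
      rintro x ⟨m, hx⟩ y hy
      obtain rfl := hf x m hx
      rcases cases y with hy' | ⟨l, hy', -⟩ | ⟨l, hy'⟩ | hy' | hy'
      · exact hFA m x y hx hy'
      · exact hFB l m x y (fun hlm => hy (Or.inl (Or.inl (hlm ▸ hy')))) hx hy'
      · exact hx.near_C h hp hd (fun hlm => hy (Or.inl (Or.inr (by subst hlm; exact hy')))) hy'
      · exact absurd (Or.inr hy') hy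
      · exact absurd hy' (hU y), by
      refine isAnticompleteBetween_of_not_near ?_
      rintro x ⟨m, hx⟩ y hy
      obtain rfl := hf x m hx
      rcases hy with hy | hy
      · exact hx.not_near_B h hp hd hy
      · exact hx.not_near_C h hp hd hy⟩ }

end FiveHoled.Frame

/-! ### Adjacency between types in the villa and mansion cases -/

namespace FiveHoled.Frame

variable {V ι : Type*} {E : V → V → Prop} {p : Frame ι V}

section

variable (h : Admissible E) (hp : p.IsPentagon E) {i j k : ι} (hd : i ≠ j ∧ i ≠ k ∧ j ≠ k)
include h hp hd

/-- Otherwise b_m, z, b_n and x, y, c_l form `2P₃`. This lets an X vertex with a neighbor of type C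
join part B_l. -/
theorem IsX.near_A_of_near_C {l : ι} {x y z : V} (hx : p.IsX E l x) (hy : p.IsC E l y) (hz : p.IsA
    E z) (hn : E x y) : E x z := by
  obtain ⟨m, n, hlmn⟩ := exists_distinct hd l
  grind only [h.symm, hp.facts hlmn, HasType.at hx l m n, HasType.at hy l m n, HasType.at hz l m
    n, h.PP (p.b m) z (p.b n) x y (p.c l), h.C4 (p.c n) y z (p.b n)]

/-- A vertex of type Y thus has neighbors of type B for at most one index, so it can be assigned to
a single C_l. -/
theorem IsB.not_near_Y_of_near_Y {l m : ι} {x y z : V} (hlm : l ≠ m) (hx : p.IsB E l x) (hy :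
    p.IsB E m y) (hz : p.IsY E z) (hn : E x z) : ¬E y z := by
  obtain ⟨n, hlmn⟩ := exists_distinct_of_ne hd hlm
  grind only [h.symm, hp.facts hlmn, HasType.at hx l m n, HasType.at hy l m n, HasType.at hz l m
    n, h.C4 z y p.a x, h.C4 x (p.c l) (p.c m) y]

theorem IsX.not_near_C {l m : ι} {x y : V} (hlm : l ≠ m) (hx : p.IsX E l x) (hy : p.IsC E m y) :
    ¬E x y := by
  obtain ⟨n, hlmn⟩ := exists_distinct_of_ne hd hlm
  grind only [h.symm, hp.facts hlmn, HasType.at hx l m n, HasType.at hy l m n, h.C4 (p.b l) x y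
    (p.c l)]

theorem IsX.not_near_Y {l : ι} {x y : V} (hx : p.IsX E l x) (hy : p.IsY E y) : ¬E x y := by
  obtain ⟨m, n, hlmn⟩ := exists_distinct hd l
  grind only [h.symm, hp.facts hlmn, HasType.at hx l m n, HasType.at hy l m n, h.C4 y x (p.b l)
    (p.c l)]

theorem IsX.not_near_B {l m : ι} {x y : V} (hlm : l ≠ m) (hx : p.IsX E l x) (hy : p.IsB E m y) :
    ¬E x y := by
  obtain ⟨n, hlmn⟩ := exists_distinct_of_ne hd hlm
  grind only [h.symm, hp.facts hlmn, HasType.at hx l m n, HasType.at hy l m n, h.PP (p.b m) y x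
    (p.b n) (p.c n) (p.c l)]

theorem IsX.not_near_X {l m : ι} {x y : V} (hlm : l ≠ m) (hx : p.IsX E l x) (hy : p.IsX E m y) :
    ¬E x y := by
  obtain ⟨n, hlmn⟩ := exists_distinct_of_ne hd hlm
  grind only [h.symm, hp.facts hlmn, HasType.at hx l m n, HasType.at hy l m n, h.PP (p.b n) (p.c
    n) (p.c l) (p.b m) y x]

theorem IsX.near {l : ι} {x y : V} (hx : p.IsX E l x) (hy : p.IsX E l y) : E x y := by
  obtain ⟨m, n, hlmn⟩ := exists_distinct hd l
  grind only [h.symm, hp.facts hlmn, HasType.at hx l m n, HasType.at hy l m n, h.PP (p.c n) (p.c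
    m) (p.b m) x (p.b l) y]

theorem IsX.near_B {l : ι} {x y : V} (hx : p.IsX E l x) (hy : p.IsB E l y) : E x y := by
  obtain ⟨m, n, hlmn⟩ := exists_distinct hd l
  grind only [h.symm, hp.facts hlmn, HasType.at hx l m n, HasType.at hy l m n, h.PP (p.b m) (p.c
    m) (p.c n) x (p.b l) y]

theorem IsY.not_near_A {x y : V} (hx : p.IsY E x) (hy : p.IsA E y) : ¬E x y := by
  grind only [h.symm, hp.facts hd, HasType.at hx i j k, HasType.at hy i j k, h.C4 x (p.b k) (p.c
    k) y, h.C4 y (p.b k) (p.c k) x]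

theorem IsY.near_C {l : ι} {x y : V} (hx : p.IsY E x) (hy : p.IsC E l y) : E x y := by
  obtain ⟨m, n, hlmn⟩ := exists_distinct hd l
  grind only [h.symm, hp.facts hlmn, HasType.at hx l m n, HasType.at hy l m n, h.PP (p.b m) p.a
    (p.b n) x (p.c l) y]

theorem IsY.near {x y : V} (hx : p.IsY E x) (hy : p.IsY E y) : E x y := by
  grind only [h.symm, hp.facts hd, HasType.at hx i j k, HasType.at hy i j k, h.PP (p.b j) p.a
    (p.b i) y (p.c k) x]

theorem IsF.near_Y {l : ι} {y x : V} (hy : p.IsF E l y) (hx : p.IsY E x) : E y x := by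
  obtain ⟨m, n, hlmn⟩ := exists_distinct hd l
  grind only [h.symm, hp.facts hlmn, HasType.at hy l m n, HasType.at hx l m n, h.PP (p.b n) y
    (p.b m) x (p.c l) (p.b l)]

theorem IsF.near_X {l : ι} {x y : V} (hx : p.IsF E l x) (hy : p.IsX E l y) : E x y := by
  obtain ⟨m, n, hlmn⟩ := exists_distinct hd l
  grind only [h.symm, hp.facts hlmn, HasType.at hx l m n, HasType.at hy l m n, h.PP (p.b m) x
    (p.b n) y (p.b l) (p.c l)]

/-- With the next two lemmas: in the branch l missed by an F vertex, no X or Y vertex is absorbed,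
and B_l is complete to C_l, as a mansion demands. -/
theorem IsF.not_near_of_X_C {l : ι} {f x y : V} (hf : p.IsF E l f) (hx : p.IsX E l x) (hy : p.IsC
    E l y) : ¬E x y := by
  obtain ⟨m, n, hlmn⟩ := exists_distinct hd l
  grind only [h.symm, hp.facts hlmn, HasType.at hf l m n, HasType.at hx l m n, HasType.at hy l m
    n, h.PP (p.b n) f (p.b m) (p.c l) y x, h.C4 y (p.b l) p.a f, h.C4 (p.c n) y x f]

theorem IsF.not_near_of_B_Y {l : ι} {f x y : V} (hf : p.IsF E l f) (hx : p.IsB E l x) (hy : p.IsY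
    E y) : ¬E x y := by
  obtain ⟨m, n, hlmn⟩ := exists_distinct hd l
  grind only [h.symm, hp.facts hlmn, HasType.at hf l m n, HasType.at hx l m n, HasType.at hy l m
    n, h.PP (p.b n) f (p.b m) y (p.c l) (p.b l), h.C4 p.a x y f, h.C4 f (p.c n) (p.c l) x]

theorem IsF.near_of_B_C {l : ι} {f x y : V} (hf : p.IsF E l f) (hx : p.IsB E l x) (hy : p.IsC E l
    y) : E x y := by
  obtain ⟨m, n, hlmn⟩ := exists_distinct hd l
  grind only [h.symm, hp.facts hlmn, HasType.at hf l m n, HasType.at hx l m n, HasType.at hy l m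
    n, h.PP x (p.b l) y (p.b m) f (p.b n), h.C4 (p.b l) y f p.a, h.C4 x f (p.c n) (p.c l)]

theorem IsF.near_X_of_near_C {l m : ι} {f x y : V} (hlm : l ≠ m) (hf : p.IsF E l f) (hx : p.IsX E
    m x) (hy : p.IsC E m y) (hn : E x y) : E f x := by
  obtain ⟨n, hlmn⟩ := exists_distinct_of_ne hd hlm
  grind only [h.symm, hp.facts hlmn, HasType.at hf l m n, HasType.at hx l m n, HasType.at hy l m
    n, h.C4 y (p.b m) f (p.c n), h.C4 x y f p.a]

theorem IsU.near_X_of_near_C {m : ι} {f x y : V} (hf : p.IsU E f) (hx : p.IsX E m x) (hy : p.IsC E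
    m y) (hn : E x y) : E f x := by
  obtain ⟨l, n, hml, hmn, hln⟩ := exists_distinct hd m
  grind only [h.symm, hp.facts ⟨hml.symm, hln, hmn⟩, HasType.at hf l m n, HasType.at hx l m n,
    HasType.at hy l m n, h.C4 (p.b m) f (p.c l) y, h.C4 f y x p.a]

theorem IsU.near_Y_of_near_B {m : ι} {f x y : V} (hf : p.IsU E f) (hx : p.IsB E m x) (hy : p.IsY E
    y) (hn : E x y) : E f y := by
  obtain ⟨l, n, hml, hmn, hln⟩ := exists_distinct hd m
  grind only [h.symm, hp.facts ⟨hml.symm, hln, hmn⟩, HasType.at hf l m n, HasType.at hx l m n,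
    HasType.at hy l m n, h.C4 p.a x (p.c m) f, h.C4 x y (p.c n) f]

theorem IsB.near {l : ι} {x y : V} (hx : p.IsB E l x) (hy : p.IsB E l y) : E x y := by
  obtain ⟨m, n, hlmn⟩ := exists_distinct hd l
  grind only [h.symm, hp.facts hlmn, HasType.at hx l m n, HasType.at hy l m n, h.PP y (p.b l) x
    (p.b m) (p.c m) (p.c n)]

theorem IsB.not_near_B {l m : ι} {x y : V} (hlm : l ≠ m) (hx : p.IsB E l x) (hy : p.IsB E m y) :
    ¬E x y := by
  obtain ⟨n, hlmn⟩ := exists_distinct_of_ne hd hlm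
  grind only [h.symm, hp.facts hlmn, HasType.at hx l m n, HasType.at hy l m n, h.C4 (p.c m) y x
    (p.c l)]

theorem IsB.not_near_C {l m : ι} {x y : V} (hlm : l ≠ m) (hx : p.IsB E l x) (hy : p.IsC E m y) :
    ¬E x y := by
  obtain ⟨n, hlmn⟩ := exists_distinct_of_ne hd hlm
  grind only [h.symm, hp.facts hlmn, HasType.at hx l m n, HasType.at hy l m n, h.C6 (p.c n) y x
    (p.b l) p.a (p.b n), h.C4 y (p.b n) p.a (p.b m), h.C4 y x p.a (p.b m), h.C4 y (p.b l) p.a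
    (p.b m), h.C6 (p.c n) (p.c m) (p.b m) p.a (p.b l) x]

theorem IsA.near {x y : V} (hx : p.IsA E x) (hy : p.IsA E y) : E x y := by
  grind only [h.symm, hp.facts hd, HasType.at hx i j k, HasType.at hy i j k, h.C4 (p.b i) x (p.b
    j) y]

theorem IsA.not_near_C {l : ι} {x y : V} (hx : p.IsA E x) (hy : p.IsC E l y) : ¬E x y := by
  obtain ⟨m, n, hlmn⟩ := exists_distinct hd l
  grind only [h.symm, hp.facts hlmn, HasType.at hx l m n, HasType.at hy l m n, h.C4 (p.c n) y x
    (p.b n)]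

theorem IsF.near_A {l : ι} {x y : V} (hx : p.IsF E l x) (hy : p.IsA E y) : E x y := by
  obtain ⟨m, n, hlmn⟩ := exists_distinct hd l
  grind only [h.symm, hp.facts hlmn, HasType.at hx l m n, HasType.at hy l m n, h.C4 (p.b m) x
    (p.b n) y]

theorem IsF.near_B {l m : ι} {x y : V} (hlm : l ≠ m) (hx : p.IsF E l x) (hy : p.IsB E m y) : E x y
    := by
  obtain ⟨n, hlmn⟩ := exists_distinct_of_ne hd hlm
  grind only [h.symm, hp.facts hlmn, HasType.at hx l m n, HasType.at hy l m n, h.C4 x (p.c m) y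
    p.a]

theorem IsF.not_near_of_isB {l : ι} {x y : V} (hx : p.IsF E l x) (hy : p.IsB E l y) : ¬E x y := by
  obtain ⟨m, n, hlmn⟩ := exists_distinct hd l
  grind only [h.symm, hp.facts hlmn, HasType.at hx l m n, HasType.at hy l m n, h.C4 (p.c m) x y
    (p.c l)]

theorem IsU.near {x y : V} (hx : p.IsU E x) (hy : p.IsU E y) : E x y := by
  grind only [h.symm, hp.facts hd, HasType.at hx i j k, HasType.at hy i j k, h.C4 (p.b i) x (p.b
    j) y]

theorem IsU.near_A {x y : V} (hx : p.IsU E x) (hy : p.IsA E y) : E x y := by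
  grind only [h.symm, hp.facts hd, HasType.at hx i j k, HasType.at hy i j k, h.C4 (p.b i) x (p.b
    j) y]

theorem IsU.near_F {l : ι} {x y : V} (hx : p.IsU E x) (hy : p.IsF E l y) : E x y := by
  obtain ⟨m, n, hlmn⟩ := exists_distinct hd l
  grind only [h.symm, hp.facts hlmn, HasType.at hx l m n, HasType.at hy l m n, h.C4 (p.b m) x
    (p.b n) y]

theorem IsU.near_B {l : ι} {x y : V} (hx : p.IsU E x) (hy : p.IsB E l y) : E x y := by
  obtain ⟨m, n, hlmn⟩ := exists_distinct hd l
  grind only [h.symm, hp.facts hlmn, HasType.at hx l m n, HasType.at hy l m n, h.C4 x (p.c l) y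
    p.a]

theorem IsU.near_C {l : ι} {x y : V} (hx : p.IsU E x) (hy : p.IsC E l y) : E x y := by
  obtain ⟨m, n, hlmn⟩ := exists_distinct hd l
  grind only [h.symm, hp.facts hlmn, HasType.at hx l m n, HasType.at hy l m n, h.C4 x (p.b l) y
    (p.c m)]

theorem IsX.near_A_of_F {l : ι} {f x y : V} (hf : p.IsF E l f) (hx : p.IsX E l x)
    (hy : p.IsA E y) : E x y := by
  have hfx := hf.near_X h hp hd hx
  have hfy := hf.near_A h hp hd hy
  grind only [h.symm, HasType.at hf l l l, HasType.at hx l l l, HasType.at hy l l l,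
    h.C4 x (p.b l) y f]

theorem IsU.near_X_of_F {l : ι} {u f x : V} (hu : p.IsU E u) (hf : p.IsF E l f)
    (hx : p.IsX E l x) : E u x := by
  have hfx := hf.near_X h hp hd hx
  have huf := hu.near_F h hp hd hf
  grind only [h.symm, HasType.at hf l l l, HasType.at hx l l l, HasType.at hu l l l,
    h.C4 x (p.b l) u f]

theorem IsU.near_Y_of_F {l : ι} {u f y : V} (hu : p.IsU E u) (hf : p.IsF E l f) (hy : p.IsY E y) :
    E u y := by
  have hfy := hf.near_Y h hp hd hy
  have huf := hu.near_F h hp hd hf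
  grind only [h.symm, HasType.at hf l l l, HasType.at hy l l l, HasType.at hu l l l,
    h.C4 y (p.c l) u f]

end
end FiveHoled.Frame

/-! ### Classification when no 3-pentagon has a vertex of type R or A' -/

namespace FiveHoled.Frame

variable {V ι : Type*} {E : V → V → Prop} {p : Frame ι V}

theorem IsPentagon.restrict (h : Admissible E) (hp : p.IsPentagon E) {i j k : ι}
    (hd : i ≠ j ∧ i ≠ k ∧ j ≠ k) :
    (⟨p.a, ![p.b i, p.b j, p.b k], ![p.c i, p.c j, p.c k]⟩ : Frame (Fin 3) V).IsPentagon E := by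
  have := hp.facts hd
  have hs := h.symm
  have hr := h.refl
  constructor
  · intro l; fin_cases l <;> simp <;> grind only
  · intro l; fin_cases l <;> simp <;> grind only
  · intro l m hlm; fin_cases l <;> fin_cases m <;> simp at hlm ⊢ <;> grind only
  · intro l m; fin_cases l <;> fin_cases m <;> simp <;> grind only
  · intro l; fin_cases l <;> simp <;> grind only
  · intro l m hlm; fin_cases l <;> fin_cases m <;> simp at hlm ⊢ <;> grind only

section

variable (h : Admissible E) (hp : p.IsPentagon E)
  (hR : ∀ q : Frame (Fin 3) V, q.IsPentagon E → ∀ i v, ¬(q.IsR E i v ∨ q.IsA' E i v))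
  {i j k : ι} (hd : i ≠ j ∧ i ≠ k ∧ j ≠ k)
include h hp hR hd

/-- Otherwise `v` is of type R for the 3-pentagon on the branches i, j, k. In the same way, the next
lemma excludes type A'. -/
theorem c_or_c_of_not_a (v : V) (ha : ¬E v p.a) (hb : E v (p.b i)) (hc : E v (p.c i)) :
    E v (p.c j) ∨ E v (p.c k) := by
  by_contra! hc'
  have h₁ : ¬E v (p.b j) := fun hb' => ha (a_of_b_b h hp hd v hb hb')
  have h₂ : ¬E v (p.b k) := fun hb' =>
    ha (a_of_b_b h hp ⟨hd.2.1, hd.1, hd.2.2.symm⟩ v hb hb')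
  refine hR _ (hp.restrict h hd) 0 v (Or.inl ⟨by simpa using ha, fun l => ?_⟩)
  fin_cases l <;> simp <;> grind only

theorem c_of_b_b_not_b (v : V) (ha : E v p.a) (hbi : E v (p.b i)) (hbj : E v (p.b j))
    (hbk : ¬E v (p.b k)) : E v (p.c i) := by
  by_contra hc
  have h₁ : ¬E v (p.c j) := fun hc' => hc (c_of_b_c h hp hd v hbi hc')
  have h₂ : ¬E v (p.c k) := fun hc' =>
    hc (c_of_b_c h hp ⟨hd.2.1, hd.1, hd.2.2.symm⟩ v hbi hc')
  refine hR _ (hp.restrict h hd) 2 v (Or.inr ⟨by simpa using ha, fun l => ?_⟩)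
  fin_cases l <;> simp <;> grind only

end

/-- Otherwise b_k, c_k, y and b_j, x, b_i form `2P₃`. Applied with `y` a further c, it shows that a
vertex that sees a and at least two b's misses at most one b. -/
theorem near_of_b_b_of_c (h : Admissible E) (hp : p.IsPentagon E) {i j k : ι}
    (hd : i ≠ j ∧ i ≠ k ∧ j ≠ k) {x y : V} (hxi : E x (p.b i)) (hxj : E x (p.b j))
    (hxk : ¬E x (p.b k)) (hyi : ¬E y (p.b i)) (hyj : ¬E y (p.b j)) (hyk : ¬E y (p.b k))
    (hyc : E y (p.c k)) : E x y := by
  grind only [h.symm, hp.facts hd, h.C4 p.a (p.b i) x (p.b j),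
    h.PP (p.b k) (p.c k) y (p.b j) x (p.b i), h.C4 (p.b k) (p.c k) x p.a]

/-- The possible types of a vertex when the graph is not a 5-basket. -/
theorem villa_cases [Finite V] (h : Admissible E) (hp : p.IsPentagon E)
    (hs : ∀ v, ¬Simplicial E v)
    (hR : ∀ q : Frame (Fin 3) V, q.IsPentagon E → ∀ i v, ¬(q.IsR E i v ∨ q.IsA' E i v))
    {i j k : ι} (hd : i ≠ j ∧ i ≠ k ∧ j ≠ k)
    (hfar : ∀ v, ∃ l, E v (p.b l) ∨ E v (p.c l)) (v : V) :
    p.IsA E v ∨ (∃ l, p.IsB E l v) ∨ (∃ l, p.IsX E l v) ∨ (∃ l, p.IsC E l v) ∨ p.IsY E v ∨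
      (∃ l, p.IsF E l v) ∨ p.IsU E v := by
  have hι := exists_ne_ne hd
  obtain ⟨l, hl⟩ := hfar v
  by_cases ha : E v p.a
  · have hbc : ∀ m, E v (p.c m) → E v (p.b m) := fun m hm => by
      obtain ⟨n, o, hmn⟩ := exists_distinct hd m
      exact b_of_a_c h hp hmn v ha hm
    have hl' : E v (p.b l) := hl.elim id (hbc l)
    have hcb : ∀ m n, E v (p.c m) → E v (p.b n) → E v (p.c n) := fun m n hm hn => by
      by_cases hmn : m = n
      · exact hmn ▸ hm
      · obtain ⟨o, hd'⟩ := exists_distinct_of_ne hd (Ne.symm hmn)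
        exact c_of_b_c h hp hd' v hn hm
    by_cases hall : ∀ m, E v (p.b m)
    · by_cases hc : E v (p.c l)
      · exact Or.inr (Or.inr (Or.inr (Or.inr (Or.inr (Or.inr
          ⟨by simpa using ha, fun m => by simp [hall m, hcb l m hc (hall m)]⟩)))))
      · exact Or.inl ⟨by simpa using ha, fun m => by
          simp [hall m]
          exact fun hm => hc (hcb m l hm hl')⟩
    push Not at hall
    obtain ⟨m, hm⟩ := hall
    by_cases hone : ∀ n, E v (p.b n) → n = l
    · by_cases hc : E v (p.c l)
      · exact Or.inr (Or.inl ⟨l, by simpa using ha, fun n => by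
          refine ⟨⟨hone n, ?_⟩, ⟨fun hn => hone n (hbc n hn), ?_⟩⟩ <;> rintro rfl <;> assumption⟩)
      · exact Or.inr (Or.inr (Or.inl ⟨l, by simpa using ha, fun n => by
          refine ⟨⟨hone n, ?_⟩, ⟨fun hn => hc (hcb n l hn hl'), False.elim⟩⟩
          rintro rfl; assumption⟩))
    push Not at hone
    obtain ⟨n, hn, hnl⟩ := hone
    have hml : m ≠ l := fun hml => hm (hml ▸ hl')
    have hmn : m ≠ n := fun hmn => hm (hmn ▸ hn)
    have hcl := c_of_b_b_not_b h hp hR ⟨hnl.symm, hml.symm, hmn.symm⟩ v ha hl' hn hm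
    have huniq : ∀ o, ¬E v (p.b o) → o = m := fun o ho => by
      by_contra hom
      have hol : o ≠ l := fun hol => ho (hol ▸ hl')
      have hon : o ≠ n := fun hon => ho (hon ▸ hn)
      refine ho (hbc o (near_of_b_b_of_c h hp ⟨hnl.symm, hml.symm, hmn.symm⟩ hl' hn hm
        ?_ ?_ ?_ (hp.cc _ _)))
      · rw [h.symm]; exact hp.bc_ne _ _ hol.symm
      · rw [h.symm]; exact hp.bc_ne _ _ hon.symm
      · rw [h.symm]; exact hp.bc_ne _ _ (Ne.symm hom)
    refine Or.inr (Or.inr (Or.inr (Or.inr (Or.inr (Or.inl ⟨m, by simpa using ha, fun o => ?_⟩)))))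
    by_cases hom : o = m
    · subst hom
      simpa [hm] using fun ho => hm (hbc _ ho)
    · have ho : E v (p.b o) := by
        by_contra ho
        exact hom (huniq o ho)
      simp [hom, ho, hcb l o hcl ho]
  · by_cases hb : ∃ m, E v (p.b m)
    · obtain ⟨m, hm⟩ := hb
      have hcm : E v (p.c m) := by
        obtain ⟨n, o, hmn⟩ := exists_distinct hd m
        exact c_of_not_a_b h hp hs hmn ha hm
      refine Or.inr (Or.inr (Or.inr (Or.inl ⟨m, by simpa using ha, fun n => ?_⟩)))
      by_cases hmn : m = n
      · subst hmn
        simp [hm, hcm]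
      obtain ⟨o, hd'⟩ := exists_distinct_of_ne hd hmn
      have h₁ : ¬E v (p.b n) := fun hn => ha (a_of_b_b h hp hd' v hm hn)
      have h₂ : E v (p.c n) := by
        rcases c_or_c_of_not_a h hp hR hd' v ha hm hcm with hc | hc
        · exact hc
        · exact c_of_not_a h hp ⟨hd'.2.1, hd'.1, hd'.2.2.symm⟩ v ha hm hc
      simp [h₁, h₂, Ne.symm hmn]
    · push Not at hb
      have hc : E v (p.c l) := hl.resolve_left (hb l)
      exact Or.inr (Or.inr (Or.inr (Or.inr (Or.inl ⟨by simpa using ha, fun m => by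
        simp [hb m, c_of_c_of_no_b h hp hs hι ha hb hc m]⟩))))

end FiveHoled.Frame

/-! ### The sides of a villa partition -/

namespace FiveHoled.Frame

variable {V ι : Type*} {E : V → V → Prop} {p : Frame ι V} {x y : V}

variable (p) (E) in
/-- The vertices that belong to `B l` in a villa partition. -/
def Upper (l : ι) (x : V) : Prop := p.IsB E l x ∨ p.IsX E l x ∧ ∃ y, p.IsC E l y ∧ E x y

variable (p) (E) in
/-- The vertices that belong to `C l` in a villa partition. -/
def Lower (l : ι) (y : V) : Prop := p.IsC E l y ∨ p.IsY E y ∧ ∃ x, p.IsB E l x ∧ E x y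

theorem IsPentagon.isB (h : Admissible E) (hp : p.IsPentagon E) (l : ι) : p.IsB E l (p.b l) := by
  refine ⟨by simpa using (h.symm _ _).1 (hp.ab l), fun m => ?_⟩
  by_cases hml : m = l
  · subst hml
    simpa using ⟨h.refl _, hp.bc m⟩
  · simpa [hml] using ⟨hp.bb _ _ (Ne.symm hml), hp.bc_ne _ _ (Ne.symm hml)⟩

theorem IsPentagon.isC (h : Admissible E) (hp : p.IsPentagon E) (l : ι) : p.IsC E l (p.c l) := by
  refine ⟨by simpa using fun hn => hp.ac l ((h.symm _ _).1 hn), fun m => ?_⟩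
  by_cases hml : m = l
  · subst hml
    simpa using ⟨(h.symm _ _).1 (hp.bc m), h.refl _⟩
  · simpa [hml] using ⟨fun hn => hp.bc_ne m l hml ((h.symm _ _).1 hn), hp.cc l m⟩

theorem IsPentagon.isA (h : Admissible E) (hp : p.IsPentagon E) : p.IsA E p.a :=
  ⟨by simpa using h.refl _, fun m => by simpa using ⟨hp.ab m, hp.ac m⟩⟩

/-- Replacing `b l` by another vertex of its type. -/
theorem IsPentagon.replace [DecidableEq ι] (h : Admissible E) (hp : p.IsPentagon E) {l : ι}
    (hx : p.IsB E l x) : (⟨p.a, Function.update p.b l x, p.c⟩ : Frame ι V).IsPentagon E := by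
  have hx' := fun m => hx.2 m
  have hs := h.symm
  constructor
  · intro m
    by_cases hm : m = l
    · subst hm; simpa using (hs _ _).1 (hx.1.2 trivial)
    · simpa [hm] using hp.ab m
  · exact hp.ac
  · intro m n hmn
    by_cases hm : m = l <;> by_cases hn : n = l
    · exact absurd (hm.trans hn.symm) hmn
    · subst hm; simpa [hn] using mt (hx' n).1.1 hn
    · subst hn; simpa [hm] using fun hn' => hm ((hx' m).1.1 ((hs _ _).1 hn'))
    · simpa [hm, hn] using hp.bb m n hmn
  · exact hp.cc
  · intro m
    by_cases hm : m = l
    · subst hm; simpa using (hx' m).2.2 rfl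
    · simpa [hm] using hp.bc m
  · intro m n hmn
    by_cases hm : m = l
    · subst hm; simpa using mt (hx' n).2.1 (Ne.symm hmn)
    · simpa [hm] using hp.bc_ne m n hmn

theorem Upper.a {l : ι} (hx : p.Upper E l x) : E x p.a :=
  hx.elim (fun hx => hx.1.2 trivial) (fun hx => hx.1.1.2 trivial)

theorem Upper.not_b {l m : ι} (hx : p.Upper E l x) (hml : m ≠ l) : ¬E x (p.b m) :=
  hx.elim (fun hx hb => hml ((hx.2 m).1.1 hb)) (fun hx hb => hml ((hx.1.2 m).1.1 hb))

theorem Lower.not_a {l : ι} (hx : p.Lower E l x) : ¬E x p.a :=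
  hx.elim IsC.not_a (fun hx => hx.1.1.1)

theorem Lower.exists_near (h : Admissible E) (hp : p.IsPentagon E) {l : ι}
    (hy : p.Lower E l y) : ∃ x, p.Upper E l x ∧ E x y := by
  rcases hy with hy | ⟨hy, z, hz, hzy⟩
  · exact ⟨p.b l, Or.inl (hp.isB h l), (h.symm _ _).1 hy.b⟩
  · exact ⟨z, Or.inl hz, hzy⟩

theorem Upper.exists_near (h : Admissible E) (hp : p.IsPentagon E) {l : ι}
    (hx : p.Upper E l x) : ∃ y, p.Lower E l y ∧ E x y := by
  rcases hx with hx | ⟨hx, z, hz, hxz⟩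
  · exact ⟨p.c l, Or.inl (hp.isC h l), (hx.2 l).2.2 rfl⟩
  · exact ⟨z, Or.inl hz, hxz⟩

section

variable (h : Admissible E) (hp : p.IsPentagon E) {i j k : ι} (hd : i ≠ j ∧ i ≠ k ∧ j ≠ k)
include h hp hd

theorem Upper.near {l : ι} (hx : p.Upper E l x) (hy : p.Upper E l y) : E x y := by
  rcases hx with hx | ⟨hx, -⟩ <;> rcases hy with hy | ⟨hy, -⟩
  · exact hx.near h hp hd hy
  · exact (h.symm _ _).1 (hy.near_B h hp hd hx)
  · exact hx.near_B h hp hd hy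
  · exact hx.near h hp hd hy

theorem Upper.not_near {l m : ι} (hlm : l ≠ m) (hx : p.Upper E l x) (hy : p.Upper E m y) :
    ¬E x y := by
  rcases hx with hx | ⟨hx, -⟩ <;> rcases hy with hy | ⟨hy, -⟩
  · exact hx.not_near_B h hp hd hlm hy
  · exact fun hn => hy.not_near_B h hp hd hlm.symm hx ((h.symm _ _).1 hn)
  · exact hx.not_near_B h hp hd hlm hy
  · exact hx.not_near_X h hp hd hlm hy

theorem Lower.near {l m : ι} (hx : p.Lower E l x) (hy : p.Lower E m y) : E x y := by
  rcases hx with hx | ⟨hx, -⟩ <;> rcases hy with hy | ⟨hy, -⟩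
  · exact hx.near h hp hd hy
  · exact (h.symm _ _).1 (hy.near_C h hp hd hx)
  · exact hx.near_C h hp hd hy
  · exact hx.near h hp hd hy

theorem Upper.not_near_Lower {l m : ι} (hlm : l ≠ m) (hx : p.Upper E l x) (hy : p.Lower E m y) :
    ¬E x y := by
  rcases hx with hx | ⟨hx, -⟩ <;> rcases hy with hy | ⟨hy, z, hz, hzy⟩
  · exact hx.not_near_C h hp hd hlm hy
  · exact hz.not_near_Y_of_near_Y h hp hd hlm.symm hx hy hzy
  · exact hx.not_near_C h hp hd hlm hy
  · exact hx.not_near_Y h hp hd hy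

/-- If `x` misses some `y` of type B_l, then replacing b_l by `y` gives a pentagon in which `x` is
of type A' on three branches. -/
theorem IsA.near_Upper {l : ι}
    (hR : ∀ q : Frame (Fin 3) V, q.IsPentagon E → ∀ i v, ¬(q.IsR E i v ∨ q.IsA' E i v))
    (hx : p.IsA E x) (hy : p.Upper E l y) : E x y := by
  classical
  rcases hy with hy | ⟨hy, z, hz, hyz⟩
  · obtain ⟨m, n, hlm, hln, hmn⟩ := exists_distinct hd l
    by_contra hxy
    have := c_of_b_b_not_b h (hp.replace h hy) hR ⟨hmn, hlm.symm, hln.symm⟩ x (hx.1.2 trivial)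
      (by simpa [hlm.symm] using (hx.2 m).1.2 trivial)
      (by simpa [hln.symm] using (hx.2 n).1.2 trivial) (by simpa using hxy)
    exact (hx.2 m).2.1 this
  · exact (h.symm _ _).1 (hy.near_A_of_near_C h hp hd hz hx hyz)

theorem IsA.not_near_Lower {l : ι} (hx : p.IsA E x) (hy : p.Lower E l y) : ¬E x y := by
  rcases hy with hy | ⟨hy, -⟩
  · exact hx.not_near_C h hp hd hy
  · exact fun hn => hy.not_near_A h hp hd hx ((h.symm _ _).1 hn)

theorem IsF.near_Upper {l m : ι} (hlm : l ≠ m) (hx : p.IsF E l x) (hy : p.Upper E m y) :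
    E x y := by
  rcases hy with hy | ⟨hy, z, hz, hyz⟩
  · exact hx.near_B h hp hd hlm hy
  · exact hx.near_X_of_near_C h hp hd hlm hy hz hyz

theorem IsF.near_Lower {l m : ι} (hlm : l ≠ m) (hx : p.IsF E l x) (hy : p.Lower E m y) :
    E x y := by
  rcases hy with hy | ⟨hy, -⟩
  · exact hx.near_C h hp hd hlm hy
  · exact hx.near_Y h hp hd hy

theorem IsF.isB_of_upper {l : ι} (hx : p.IsF E l x) (hy : p.Upper E l y) : p.IsB E l y := by
  rcases hy with hy | ⟨hy, z, hz, hyz⟩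
  · exact hy
  · exact absurd hyz (hx.not_near_of_X_C h hp hd hy hz)

theorem IsF.isC_of_lower {l : ι} (hx : p.IsF E l x) (hy : p.Lower E l y) : p.IsC E l y := by
  rcases hy with hy | ⟨hy, z, hz, hyz⟩
  · exact hy
  · exact absurd hyz (hx.not_near_of_B_Y h hp hd hz hy)

theorem IsU.near_Upper {l : ι} (hx : p.IsU E x) (hy : p.Upper E l y) : E x y := by
  rcases hy with hy | ⟨hy, z, hz, hyz⟩
  · exact hx.near_B h hp hd hy
  · exact hx.near_X_of_near_C h hp hd hy hz hyz

theorem IsU.near_Lower {l : ι} (hx : p.IsU E x) (hy : p.Lower E l y) : E x y := by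
  rcases hy with hy | ⟨hy, z, hz, hyz⟩
  · exact hx.near_C h hp hd hy
  · exact hx.near_Y_of_near_B h hp hd hz hy hyz

end

section

variable [Finite V] (h : Admissible E) (hp : p.IsPentagon E) (hs : ∀ v, ¬Simplicial E v)
  (hR : ∀ q : Frame (Fin 3) V, q.IsPentagon E → ∀ i v, ¬(q.IsR E i v ∨ q.IsA' E i v))
  {i j k : ι} (hd : i ≠ j ∧ i ≠ k ∧ j ≠ k) (hfar : ∀ v, ∃ l, E v (p.b l) ∨ E v (p.c l))
include h hp hs hR hd hfar

/-- The X_l vertices without a neighbor of type C_l form a clique, and their outside neighbors lie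
in part B_l, A, U or an F_m with m ≠ l. These are pairwise adjacent, so a simplicial vertex would
arise. -/
theorem IsX.upper {l : ι} (hF : ∀ f, ¬p.IsF E l f) (hx : p.IsX E l x) : p.Upper E l x := by
  by_contra hx'
  have hx' : ∀ y, p.IsC E l y → ¬E x y := fun y hy hxy => hx' (Or.inr ⟨hx, y, hy, hxy⟩)
  have nbr : ∀ v y, (p.IsX E l v ∧ ∀ z, p.IsC E l z → ¬E v z) →
      ¬(p.IsX E l y ∧ ∀ z, p.IsC E l z → ¬E y z) → E v y →
      p.Upper E l y ∨ p.IsA E y ∨ (∃ m, l ≠ m ∧ p.IsF E m y) ∨ p.IsU E y := by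
    rintro v y ⟨hv, hv'⟩ hy hvy
    rcases villa_cases h hp hs hR hd hfar y with h' | ⟨m, h'⟩ | ⟨m, h'⟩ | ⟨m, h'⟩ | h' | ⟨m, h'⟩ | h'
    · exact Or.inr (Or.inl h')
    · by_cases hlm : l = m
      · exact Or.inl (Or.inl (hlm ▸ h'))
      · exact absurd hvy (hv.not_near_B h hp hd hlm h')
    · by_cases hlm : l = m
      · subst hlm
        by_contra hno
        exact hy ⟨h', fun z hz hyz => hno (Or.inl (Or.inr ⟨h', z, hz, hyz⟩))⟩
      · exact absurd hvy (hv.not_near_X h hp hd hlm h')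
    · by_cases hlm : l = m
      · subst hlm
        exact absurd hvy (hv' y h')
      · exact absurd hvy (hv.not_near_C h hp hd hlm h')
    · exact absurd hvy (hv.not_near_Y h hp hd h')
    · exact Or.inr (Or.inr (Or.inl ⟨m, fun hlm => hF y (hlm ▸ h'), h'⟩))
    · exact Or.inr (Or.inr (Or.inr h'))
  refine not_exists.2 hs (h.exists_simplicial
    (K := fun v => p.IsX E l v ∧ ∀ z, p.IsC E l z → ¬E v z) ⟨x, hx, hx'⟩
    (fun v w hv hw => hv.1.near h hp hd hw.1) ?_)
  intro v w y z hv hw hy hz hvy hwz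
  rcases nbr v y hv hy hvy with hy | hy | ⟨m, hlm, hy⟩ | hy <;>
    rcases nbr w z hw hz hwz with hz | hz | ⟨n, hln, hz⟩ | hz
  · exact hy.near h hp hd hz
  · exact (h.symm _ _).1 (hz.near_Upper h hp hd hR hy)
  · exact (h.symm _ _).1 (hz.near_Upper h hp hd hln.symm hy)
  · exact (h.symm _ _).1 (hz.near_Upper h hp hd hy)
  · exact hy.near_Upper h hp hd hR hz
  · exact hy.near h hp hd hz
  · exact (h.symm _ _).1 (hz.near_A h hp hd hy)
  · exact (h.symm _ _).1 (hz.near_A h hp hd hy)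
  · exact hy.near_Upper h hp hd hlm.symm hz
  · exact hy.near_A h hp hd hz
  · obtain rfl := hy.eq h hp hd hz
    exact hy.near h hp hd hz
  · exact (h.symm _ _).1 (hz.near_F h hp hd hy)
  · exact hy.near_Upper h hp hd hz
  · exact hy.near_A h hp hd hz
  · exact hy.near_F h hp hd hz
  · exact hy.near h hp hd hz

/-- The Y vertices without a neighbor of type B form a clique with outside neighbors in the parts
C_l and U only, so again a simplicial vertex would arise. -/
theorem IsY.exists_lower (hF : ∀ l f, ¬p.IsF E l f) (hx : p.IsY E x) : ∃ l, p.Lower E l x := by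
  by_contra! hx'
  have hx' : ∀ l y, p.IsB E l y → ¬E x y := fun l y hy hxy =>
    hx' l (Or.inr ⟨hx, y, hy, (h.symm _ _).1 hxy⟩)
  have nbr : ∀ v y, (p.IsY E v ∧ ∀ l z, p.IsB E l z → ¬E v z) →
      ¬(p.IsY E y ∧ ∀ l z, p.IsB E l z → ¬E y z) → E v y → (∃ l, p.Lower E l y) ∨ p.IsU E y := by
    rintro v y ⟨hv, hv'⟩ hy hvy
    rcases villa_cases h hp hs hR hd hfar y with h' | ⟨m, h'⟩ | ⟨m, h'⟩ | ⟨m, h'⟩ | h' | ⟨m, h'⟩ | h'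
    · exact absurd hvy (hv.not_near_A h hp hd h')
    · exact absurd hvy (hv' m y h')
    · exact absurd ((h.symm _ _).1 hvy) (h'.not_near_Y h hp hd hv)
    · exact Or.inl ⟨m, Or.inl h'⟩
    · by_contra hno
      exact hy ⟨h', fun l z hz hyz => hno (Or.inl ⟨l, Or.inr ⟨h', z, hz, (h.symm _ _).1 hyz⟩⟩)⟩
    · exact absurd h' (hF m y)
    · exact Or.inr h'
  refine not_exists.2 hs (h.exists_simplicial
    (K := fun v => p.IsY E v ∧ ∀ l z, p.IsB E l z → ¬E v z) ⟨x, hx, hx'⟩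
    (fun v w hv hw => hv.1.near h hp hd hw.1) ?_)
  intro v w y z hv hw hy hz hvy hwz
  rcases nbr v y hv hy hvy with ⟨l, hy⟩ | hy <;> rcases nbr w z hw hz hwz with ⟨m, hz⟩ | hz
  · exact hy.near h hp hd hz
  · exact (h.symm _ _).1 (hz.near_Lower h hp hd hy)
  · exact hy.near_Lower h hp hd hz
  · exact hy.near h hp hd hz

/-- A vertex that has all the `b l` and `c l` as neighbors is universal. -/
theorem IsU.near_all (hx : p.IsU E x) (y : V) : E x y := by
  rcases villa_cases h hp hs hR hd hfar y with h' | ⟨l, h'⟩ | ⟨l, h'⟩ | ⟨l, h'⟩ | h' | ⟨l, h'⟩ | h'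
  · exact hx.near_A h hp hd h'
  · exact hx.near_B h hp hd h'
  · by_cases hF : ∃ f, p.IsF E l f
    · obtain ⟨f, hf⟩ := hF
      exact hx.near_X_of_F h hp hd hf h'
    · exact hx.near_Upper h hp hd (h'.upper h hp hs hR hd hfar (not_exists.1 hF))
  · exact hx.near_C h hp hd h'
  · by_cases hF : ∃ l f, p.IsF E l f
    · obtain ⟨l, f, hf⟩ := hF
      exact hx.near_Y_of_F h hp hd hf h'
    · push Not at hF
      obtain ⟨l, hl⟩ := h'.exists_lower h hp hs hR hd hfar hF
      exact hx.near_Lower h hp hd hl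
  · exact hx.near_F h hp hd h'
  · exact hx.near h hp hd h'

end
end FiveHoled.Frame

/-! ### Assembling the villa and the mansion -/

namespace FiveHoled.Frame

variable {V : Type*} {G : SimpleGraph V} {t : ℕ} {p : Frame (Fin t) V}

/-- Take `x` with the most neighbors in the lower part. If it misses `y`, an upper neighbor `z` of
`y` sees `y` and, by `C₄`, every lower neighbor of `x`, against maximality. -/
theorem exists_upper_near_lower [Finite V] {ι : Type*} {E : V → V → Prop} {p : Frame ι V}
    (h : Admissible E) (hp : p.IsPentagon E) {i j k : ι} (hd : i ≠ j ∧ i ≠ k ∧ j ≠ k) (l : ι) :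
    ∃ x, p.Upper E l x ∧ ∀ y, p.Lower E l y → E x y := by
  obtain ⟨x, hx, hmax⟩ := Set.exists_max_image {x | p.Upper E l x}
    (fun x => {y | p.Lower E l y ∧ E x y}.ncard) (Set.toFinite _) ⟨p.b l, Or.inl (hp.isB h l)⟩
  refine ⟨x, hx, fun y hy => ?_⟩
  by_contra hxy
  obtain ⟨z, hz, hzy⟩ := hy.exists_near h hp
  refine absurd (hmax z hz) (not_le.2 (Set.ncard_lt_ncard ⟨fun w ⟨hw, hxw⟩ => ⟨hw, ?_⟩,
    fun hle => hxy (hle ⟨hy, hzy⟩).2⟩ (Set.toFinite _)))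
  have hxz := Upper.near h hp hd hx hz
  have hyw := Lower.near h hp hd hy hw
  have := h.C4 x z y w
  grind only [h.symm]

theorem isVillaPartitionOn [Finite V] (h : Admissible (Near G)) (hp : p.IsPentagon (Near G))
    (hR : ∀ q : Frame (Fin 3) V, q.IsPentagon (Near G) →
      ∀ i v, ¬(q.IsR (Near G) i v ∨ q.IsA' (Near G) i v))
    {i j k : Fin t} (hd : i ≠ j ∧ i ≠ k ∧ j ≠ k) {S : Set V}
    (hS : ∀ x, x ∈ S ↔ p.IsA (Near G) x ∨ (∃ l, p.Upper (Near G) l x) ∨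
      ∃ l, p.Lower (Near G) l x) :
    IsVillaPartitionOn G S {x | p.IsA (Near G) x} (fun l => {x | p.Upper (Near G) l x})
      (fun l => {x | p.Lower (Near G) l x}) := by
  have hAB : ∀ l, Disjoint {x | p.IsA (Near G) x} {x | p.Upper (Near G) l x} := fun l =>
    Set.disjoint_left.2 fun x hx hy => by
      obtain ⟨m, hm, -⟩ := exists_ne_ne hd l l
      exact hy.not_b hm ((hx.2 m).1.2 trivial)
  have hBC : ∀ l m, Disjoint {x | p.Upper (Near G) l x} {x | p.Lower (Near G) m x} :=
    fun l m => Set.disjoint_left.2 fun x hx hy => hy.not_a hx.a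
  have hCC : ∀ l m, l ≠ m → Disjoint {x | p.Lower (Near G) l x} {x | p.Lower (Near G) m x} :=
    fun l m hlm => Set.disjoint_left.2 fun x hx hy => by
      obtain ⟨z, hz, hzx⟩ := hx.exists_near h hp
      exact hz.not_near_Lower h hp hd hlm hy hzx
  exact
  { disjoint_A_B := hAB
    disjoint_A_C := fun l => Set.disjoint_left.2 fun x hx hy => hy.not_a (hx.1.2 trivial)
    disjoint_B_B := fun l m hlm => Set.disjoint_left.2 fun x hx hy =>
      hx.not_near h hp hd hlm hy (h.refl x)
    disjoint_B_C := hBC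
    disjoint_C_C := hCC
    cover := by
      ext x
      simp only [hS, Set.mem_union, Set.mem_iUnion, Set.mem_ofPred_eq, or_assoc]
    nonempty_A := ⟨p.a, hp.isA h⟩
    nonempty_B := fun l => ⟨p.b l, Or.inl (hp.isB h l)⟩
    nonempty_C := fun l => ⟨p.c l, Or.inl (hp.isC h l)⟩
    clique_A := isClique_of_near fun x hx y hy => hx.near h hp hd hy
    clique_B := fun l => isClique_of_near fun x hx y hy => hx.near h hp hd hy
    clique_C := fun l => isClique_of_near fun x hx y hy => hx.near h hp hd hy
    A_complete_B := fun l => isCompleteBetween_of_near (hAB l)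
      fun x hx y hy => hx.near_Upper h hp hd hR hy
    A_anticomplete_C := fun l => isAnticompleteBetween_of_not_near fun x hx y hy =>
      hx.not_near_Lower h hp hd hy
    B_anticomplete_B := fun l m hlm => isAnticompleteBetween_of_not_near fun x hx y hy =>
      hx.not_near h hp hd hlm hy
    C_complete_C := fun l m hlm => isCompleteBetween_of_near (hCC l m hlm)
      fun x hx y hy => hx.near h hp hd hy
    B_anticomplete_C := fun l m hlm => isAnticompleteBetween_of_not_near fun x hx y hy =>
      hx.not_near_Lower h hp hd hlm hy
    B_C := fun l => by
      obtain ⟨n, e, he⟩ := exists_isNestedOrdering_of_near h (hBC l l)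
        (fun x hx y hy => hx.near h hp hd hy) (fun x hx y hy => hx.near h hp hd hy)
        (exists_upper_near_lower h hp hd l)
      -- Every upper vertex has a lower neighbor by definition, in particular the last one of the
      -- ordering.
      have hmem : p.Upper (Near G) l (e (Fin.last n)) :=
        (Set.ext_iff.1 he.range_eq _).1 (Set.mem_range_self _)
      obtain ⟨y, hy, hey⟩ := hmem.exists_near h hp
      refine ⟨n, e, he, y, hey.resolve_left fun hey => ?_, hy⟩
      exact hy.not_a (hey ▸ hmem.a) }

section

variable [Finite V] (h : Admissible (Near G)) (hp : p.IsPentagon (Near G))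
  (hs : ∀ v, ¬Simplicial (Near G) v) (hu : ∀ v, ∃ w, ¬Near G v w)
  (hR : ∀ q : Frame (Fin 3) V, q.IsPentagon (Near G) →
    ∀ i v, ¬(q.IsR (Near G) i v ∨ q.IsA' (Near G) i v))
  {i j k : Fin t} (hd : i ≠ j ∧ i ≠ k ∧ j ≠ k)
  (hfar : ∀ v, ∃ l, Near G v (p.b l) ∨ Near G v (p.c l))
include h hp hs hu hR hd hfar

theorem isVilla_of_not_isF (ht : 3 ≤ t) (hF : ∀ l f, ¬p.IsF (Near G) l f) : IsVilla G := by
  refine ⟨t, ht, _, _, _, isVillaPartitionOn h hp hR hd fun x => iff_of_true trivial ?_⟩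
  rcases villa_cases h hp hs hR hd hfar x with h' | ⟨l, h'⟩ | ⟨l, h'⟩ | ⟨l, h'⟩ | h' | ⟨l, h'⟩ | h'
  · exact Or.inl h'
  · exact Or.inr (Or.inl ⟨l, Or.inl h'⟩)
  · exact Or.inr (Or.inl ⟨l, h'.upper h hp hs hR hd hfar (hF l)⟩)
  · exact Or.inr (Or.inr ⟨l, Or.inl h'⟩)
  · exact Or.inr (Or.inr (h'.exists_lower h hp hs hR hd hfar hF))
  · exact absurd h' (hF l x)
  · obtain ⟨w, hw⟩ := hu x
    exact absurd (h'.near_all h hp hs hR hd hfar w) hw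

/-- All F vertices have index `r`, so `IsX.upper` absorbs X_l for l ≠ r. Because of `f`, no vertex
of type X_r is absorbed, and X_r becomes the part X; the part Y consists of the Y vertices assigned
to no C_l. -/
theorem isMansion_of_isF (ht : 3 ≤ t) {r : Fin t} {f : V} (hf : p.IsF (Near G) r f) :
    IsMansion G := by
  have hF : ∀ l x, p.IsF (Near G) l x → l = r := fun l x hx => hx.eq h hp hd hf
  have hFA : ∀ x, p.IsF (Near G) r x → ¬p.IsA (Near G) x := fun x hx hy =>
    hx.not_b ((hy.2 r).1.2 trivial)
  have hFB : ∀ l x, p.IsF (Near G) r x → ¬p.Upper (Near G) l x := fun l x hx hy => by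
    obtain ⟨m, hml, hmr⟩ := exists_ne_ne hd l r
    exact hy.not_b hml (hx.b hmr)
  have hFC : ∀ l x, p.IsF (Near G) r x → ¬p.Lower (Near G) l x := fun l x hx hy => hy.not_a hx.a
  have hFX : ∀ x, p.IsF (Near G) r x → ¬p.IsX (Near G) r x := fun x hx hy =>
    hx.not_b ((hy.2 r).1.2 rfl)
  have hFY : ∀ x, p.IsF (Near G) r x → ¬p.IsY (Near G) x := fun x hx hy => hy.1.1 hx.a
  have hXY : ∀ x, p.IsX (Near G) r x → ¬p.IsY (Near G) x := fun x hx hy =>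
    hy.1.1 (hx.1.2 trivial)
  have hXA : ∀ x, p.IsX (Near G) r x → ¬p.IsA (Near G) x := fun x hx hy => by
    obtain ⟨m, hm, -⟩ := exists_ne_ne hd r r
    exact hm ((hx.2 m).1.1 ((hy.2 m).1.2 trivial))
  have hXB : ∀ l x, p.IsX (Near G) r x → ¬p.Upper (Near G) l x := fun l x hx hy => by
    by_cases hl : r = l
    · subst hl
      exact (hx.2 r).2.1 (((hf.isB_of_upper h hp hd hy).2 r).2.2 rfl)
    · exact hy.not_b hl ((hx.2 r).1.2 rfl)
  have hXC : ∀ l x, p.IsX (Near G) r x → ¬p.Lower (Near G) l x := fun l x hx hy =>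
    hy.not_a (hx.1.2 trivial)
  refine ⟨t, ht, {x | p.IsA (Near G) x}, fun l => {x | p.Upper (Near G) l x},
    fun l => {x | p.Lower (Near G) l x}, {x | p.IsF (Near G) r x}, {x | p.IsX (Near G) r x},
    {x | p.IsY (Near G) x ∧ ∀ l, ¬p.Lower (Near G) l x}, ?_⟩
  exact
  { disjoint_F_X := Set.disjoint_left.2 hFX
    disjoint_F_Y := Set.disjoint_left.2 fun x hx hy => hFY x hx hy.1
    disjoint_X_Y := Set.disjoint_left.2 fun x hx hy => hXY x hx hy.1
    villa := isVillaPartitionOn h hp hR hd fun x => by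
      simp only [Set.mem_compl_iff, Set.mem_union, Set.mem_ofPred_eq, not_or]
      constructor
      · rintro ⟨⟨hxF, hxX⟩, hxY⟩
        rcases villa_cases h hp hs hR hd hfar x with
          h' | ⟨l, h'⟩ | ⟨l, h'⟩ | ⟨l, h'⟩ | h' | ⟨l, h'⟩ | h'
        · exact Or.inl h'
        · exact Or.inr (Or.inl ⟨l, Or.inl h'⟩)
        · refine Or.inr (Or.inl ⟨l, h'.upper h hp hs hR hd hfar fun y hy => ?_⟩)
          exact hxX (hF l y hy ▸ h')
        · exact Or.inr (Or.inr ⟨l, Or.inl h'⟩)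
        · exact Or.inr (Or.inr (by simpa using not_and.1 hxY h'))
        · exact absurd (hF l x h' ▸ h') hxF
        · obtain ⟨w, hw⟩ := hu x
          exact absurd (h'.near_all h hp hs hR hd hfar w) hw
      · rintro (hx | ⟨l, hx⟩ | ⟨l, hx⟩)
        · exact ⟨⟨fun h' => hFA x h' hx, fun h' => hXA x h' hx⟩, fun h' => h'.1.1.1 (hx.1.2 trivial)⟩
        · exact ⟨⟨fun h' => hFB l x h' hx, fun h' => hXB l x h' hx⟩, fun h' => h'.1.1.1 hx.a⟩
        · exact ⟨⟨fun h' => hFC l x h' hx, fun h' => hXC l x h' hx⟩, fun h' => h'.2 l hx⟩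
    nonempty_F := ⟨f, hf⟩
    clique_F := isClique_of_near fun x hx y hy => hx.near h hp hd hy
    clique_X := isClique_of_near fun x hx y hy => hx.near h hp hd hy
    clique_Y := isClique_of_near fun x hx y hy => hx.1.near h hp hd hy.1
    special := ⟨r,
      isCompleteBetween_of_near (Set.disjoint_left.2 hFA) fun x hx y hy => hx.near_A h hp hd hy,
      fun l hl => isCompleteBetween_of_near (Set.disjoint_left.2 (hFB l)) fun x hx y hy =>
        hx.near_Upper h hp hd hl.symm hy,
      fun l hl => isCompleteBetween_of_near (Set.disjoint_left.2 (hFC l)) fun x hx y hy =>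
        hx.near_Lower h hp hd hl.symm hy,
      isAnticompleteBetween_of_not_near fun x hx y hy => hy.elim
        (fun hy => hx.not_near_of_isB h hp hd (hx.isB_of_upper h hp hd hy))
        (fun hy => hx.not_near_C h hp hd (hx.isC_of_lower h hp hd hy)),
      isCompleteBetween_of_near (Set.disjoint_left.2 fun x hx hy => hy.not_a hx.a)
        fun x hx y hy => hf.near_of_B_C h hp hd (hf.isB_of_upper h hp hd hx)
          (hf.isC_of_lower h hp hd hy),
      isCompleteBetween_of_near
        (Set.disjoint_left.2 fun x hx hy => hy.elim (hXA x hx) (hXB r x hx))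
        fun x hx y hy => hy.elim (fun hy => hx.near_A_of_F h hp hd hf hy)
          (fun hy => hx.near_B h hp hd (hf.isB_of_upper h hp hd hy)),
      fun l hl => isAnticompleteBetween_of_not_near fun x hx y hy => hy.elim
        (fun hy => hx.not_near_B h hp hd hl.symm hy)
        (fun hy => hx.not_near_X h hp hd hl.symm hy.1),
      fun l => isAnticompleteBetween_of_not_near fun x hx y hy hxy => hXB r x hx (Or.inr ⟨hx, by
        rcases hy with hy | ⟨hy, -⟩
        · by_cases hl : r = l
          · exact ⟨y, hl ▸ hy, hxy⟩
          · exact absurd hxy (hx.not_near_C h hp hd hl hy)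
        · exact absurd hxy (hx.not_near_Y h hp hd hy)⟩)⟩
    F_complete := isCompleteBetween_of_near
      (Set.disjoint_left.2 fun x hx hy => hy.elim (hFX x hx) (fun hy => hFY x hx hy.1))
      fun x hx y hy => hy.elim (fun hy => hx.near_X h hp hd hy)
        (fun hy => hx.near_Y h hp hd hy.1)
    X_anticomplete_Y := isAnticompleteBetween_of_not_near fun x hx y hy =>
      hx.not_near_Y h hp hd hy.1
    Y_complete_C := fun l => isCompleteBetween_of_near
      (Set.disjoint_left.2 fun x hx hy => hx.2 l hy)
      fun x hx y hy => hy.elim (fun hy => hx.1.near_C h hp hd hy)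
        (fun hy => hx.1.near h hp hd hy.1)
    Y_anticomplete_A := isAnticompleteBetween_of_not_near fun x hx y hy =>
      hx.1.not_near_A h hp hd hy
    Y_anticomplete_B := fun l => isAnticompleteBetween_of_not_near fun x hx y hy hxy => by
      replace hxy := (h.symm _ _).1 hxy
      rcases hy with hy | ⟨hy, -⟩
      · exact hx.2 l (Or.inr ⟨hx.1, y, hy, hxy⟩)
      · exact hy.not_near_Y h hp hd hx.1 hxy }

end
end FiveHoled.Frame

/-! ### A maximal pentagon, and the conclusion -/

namespace FiveHoled

variable {V : Type*}

namespace Frame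

theorem IsPentagon.cons {E : V → V → Prop} (h : Admissible E) {t : ℕ} {p : Frame (Fin t) V}
    (hp : p.IsPentagon E) {w y : V} (hw : ∀ l, ¬E w (p.b l) ∧ ¬E w (p.c l)) (hwa : E w p.a)
    (hwy : E w y) (hya : ¬E y p.a) (hyb : ∀ l, ¬E y (p.b l)) (hyc : ∀ l, E y (p.c l)) :
    (⟨p.a, Fin.cons w p.b, Fin.cons y p.c⟩ : Frame (Fin (t + 1)) V).IsPentagon E := by
  have hs := h.symm
  constructor
  · intro l
    cases l using Fin.cases with
    | zero => simpa using (hs _ _).1 hwa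
    | succ l => simpa using hp.ab l
  · intro l
    cases l using Fin.cases with
    | zero => simpa using fun hn => hya ((hs _ _).1 hn)
    | succ l => simpa using hp.ac l
  · intro l m hlm
    cases l using Fin.cases with
    | zero =>
      cases m using Fin.cases with
      | zero => exact absurd rfl hlm
      | succ m => simpa using (hw m).1
    | succ l =>
      cases m using Fin.cases with
      | zero => simpa using fun hn => (hw l).1 ((hs _ _).1 hn)
      | succ m => simpa using hp.bb l m (fun hn => hlm (congrArg _ hn))
  · intro l m
    cases l using Fin.cases with
    | zero =>
      cases m using Fin.cases with
      | zero => exact h.refl _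
      | succ m => simpa using hyc m
    | succ l =>
      cases m using Fin.cases with
      | zero => simpa using (hs _ _).1 (hyc l)
      | succ m => simpa using hp.cc l m
  · intro l
    cases l using Fin.cases with
    | zero => simpa using hwy
    | succ l => simpa using hp.bc l
  · intro l m hlm
    cases l using Fin.cases with
    | zero =>
      cases m using Fin.cases with
      | zero => exact absurd rfl hlm
      | succ m => simpa using (hw m).2
    | succ l =>
      cases m using Fin.cases with
      | zero => simpa using fun hn => hyb l ((hs _ _).1 hn)
      | succ m => simpa using hp.bc_ne l m (fun hn => hlm (congrArg _ hn))

theorem exists_maximal [Finite V] {E : V → V → Prop} (h : Admissible E)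
    (hp : ∃ p : Frame (Fin 3) V, p.IsPentagon E) :
    ∃ t, 3 ≤ t ∧ (∃ p : Frame (Fin t) V, p.IsPentagon E) ∧
      ∀ q : Frame (Fin (t + 1)) V, ¬q.IsPentagon E := by
  by_contra! hno
  have hall : ∀ t, 3 ≤ t → ∃ p : Frame (Fin t) V, p.IsPentagon E := fun t ht => by
    induction t, ht using Nat.le_induction with
    | base => exact hp
    | succ t ht ih => exact hno t ht ih
  -- The b's of a pentagon are distinct, so a pentagon has at most `Nat.card V` branches.
  obtain ⟨p, hp⟩ := hall (Nat.card V + 3) (Nat.le_add_left _ _)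
  have hinj : Function.Injective p.b := fun l m hlm => by
    by_contra hne
    exact hp.bb l m hne (hlm ▸ h.refl _)
  have := Nat.card_le_card_of_injective p.b hinj
  simp at this

theorem exists_isPentagon_of_isIndContained {G : SimpleGraph V} {t : ℕ}
    (hG : (pentagon t).IsIndContained G) : ∃ p : Frame (Fin t) V, p.IsPentagon (Near G) := by
  obtain ⟨f⟩ := hG
  have hf : ∀ x y, Near G (f x) (f y) ↔ Near (pentagon t) x y := fun x y => by
    simp [Near, f.map_adj_iff]
  refine ⟨⟨f .a, fun l => f (.b l), fun l => f (.c l)⟩, ?_⟩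
  constructor <;> intros <;> rw [hf] <;> simp_all [Near, pentagon, em]

end Frame

theorem isSimplicial_of_simplicial {G : SimpleGraph V} {v : V} (hv : Simplicial (Near G) v) :
    IsSimplicial G v :=
  fun x hx y hy hxy => (hv x y (Or.inr hx) (Or.inr hy)).resolve_left hxy

end FiveHoled

theorem mainTheorem8 {V : Type*} [Finite V] (G : SimpleGraph V)
    (h2P3 : FiveHoled.IndFree FiveHoled.twoP3 G)
    (hC4 : FiveHoled.IndFree (SimpleGraph.cycleGraph 4) G)
    (hC6 : FiveHoled.IndFree (SimpleGraph.cycleGraph 6) G)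
    (hC7 : FiveHoled.IndFree (SimpleGraph.cycleGraph 7) G)
    (hT0 : FiveHoled.IndFree FiveHoled.T0 G)
    (hpentagon : (FiveHoled.pentagon 3).IsIndContained G) :
    (FiveHoled.IsFiveBasket G ∨ FiveHoled.IsVilla G ∨ FiveHoled.IsMansion G) ∨
      (∃ v, FiveHoled.IsSimplicial G v) ∨ (∃ v, G.IsUniversal v) := by
  open FiveHoled FiveHoled.Frame in
  have h := admissible_near h2P3 hC4 hC6 hC7 hT0
  by_contra! hno
  obtain ⟨⟨hbasket, hvilla, hmansion⟩, hsimp, huniv⟩ := hno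
  have hs : ∀ v, ¬Simplicial (Near G) v := fun v hv => hsimp v (isSimplicial_of_simplicial hv)
  have hu : ∀ v, ∃ w, ¬Near G v w := fun v => by
    by_contra! hv
    exact huniv v fun w hw => (hv w).resolve_left hw
  -- This has to hold for every 3-pentagon, since it is applied to restrictions of the large
  -- pentagon and to those with a replaced b.
  have hR : ∀ q : Frame (Fin 3) V, q.IsPentagon (Near G) →
      ∀ i v, ¬(q.IsR (Near G) i v ∨ q.IsA' (Near G) i v) := fun q hq i v hv => by
    obtain ⟨j, k, hd⟩ := exists_distinct (i := (0 : Fin 3)) (j := 1) (k := 2) (by decide) i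
    exact hbasket (isFiveBasket_of_R_or_A' h hq hs hu hd hv)
  obtain ⟨t, ht, ⟨p, hp⟩, hmax⟩ := exists_maximal h (exists_isPentagon_of_isIndContained hpentagon)
  have hd : (⟨0, by omega⟩ : Fin t) ≠ ⟨1, by omega⟩ ∧ (⟨0, by omega⟩ : Fin t) ≠ ⟨2, by omega⟩ ∧
      (⟨1, by omega⟩ : Fin t) ≠ ⟨2, by omega⟩ := by simp
  have hfar : ∀ v, ∃ l, Near G v (p.b l) ∨ Near G v (p.c l) := fun v => by
    by_contra! hv
    obtain ⟨w, y, hw, hwa, hwy, hya, hyb, hyc⟩ :=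
      exists_far_near_Y h hp hs (exists_ne_ne hd) ⟨0, by omega⟩ hv
    exact hmax _ (hp.cons h hw hwa hwy hya hyb hyc)
  by_cases hF : ∃ l f, p.IsF (Near G) l f
  · obtain ⟨l, f, hf⟩ := hF
    exact hmansion (isMansion_of_isF h hp hs hu hR hd hfar ht hf)
  · push Not at hF
    exact hvilla (isVilla_of_not_isF h hp hs hu hR hd hfar ht hF)
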